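/- Let $T,n\ge 1$ and consider the linear time-varying system $x_{k+1}=A_kx_k+B_ku_k+E_kw_k$ with $x_k\in\mathbb R^n$, $u_k\in\mathbb R^m$, $w_k\in\mathbb R^p$, a known initial state $x_0$, and matrices $E_k\in\mathbb R^{n\times p}$ of full row rank. Put $\mathbf x=(x_0,\dots,x_T)$, $\mathbf u=(u_0,\dots,u_T)$, $\mathbf w=(w_0,\dots,w_{T-1})$, $\delta=(x_0,\mathbf w)$. Let $$J(\delta,\mathbf u)=\sum_{k=0}^T x_k^\top Q_kx_k+u_k^\top R_ku_k=\mathbf x^\top\mathcal Q\mathbf x+\mathbf u^\top\mathcal R\mathbf u,\qquad Q_k\succeq0,\ R_k\succ0,$$ $\mathcal Q=\mathrm{blkdiag}(Q_k)$, $\mathcal R=\mathrm{blkdiag}(R_k)$, $\mathcal C=\mathrm{blkdiag}(\mathcal Q,\mathcal R)$, and let $J^*(\delta)=\min_{\tilde{\mathbf u}}J(\delta,\tilde{\mathbf u})$ be the optimal non-causal cost. Let $\mathcal A=\mathrm{blkdiag}(A_0,\dots,A_T)$, $\mathcal B=\mathrm{blkdiag}(B_0,\dots,B_T)$, $\mathcal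 E=\mathrm{blkdiag}(I,E_0,\dots,E_{T-1})$, let $\mathcal Z$ be the block downshift, $F=(I-\mathcal Z\mathcal A)^{-1}\mathcal Z\mathcal B$, $G=(I-\mathcal Z\mathcal A)^{-1}\mathcal E$ (so $\mathbf x=F\mathbf u+G\delta$) and $\mathcal O=G^\top\mathcal Q(I+F\mathcal R^{-1}F^\top\mathcal Q)^{-1}G$. Let $\mathcal W_w\succ0$ be a weight of the size of $\delta$ with condition number $\kappa(\mathcal W_w)=\sigma_{\max}(\mathcal W_w)/\sigma_{\min}(\mathcal W_w)$, let $P\in\mathbb R^{p\times p}$, $P\succ0$, and $\mathbb W=\{w\in\mathbb R^p: w^\top Pw\le1\}$. Write $\mathcal O=\begin{bmatrix}\mathcal O_1&\mathcal O_2^\top\\ \mathcal O_2&\mathcal O_3\end{bmatrix}$ and $\mathcal W_w=\begin{bmatrix}\mathcal W_1&\mathcal W_2^\top\\ \mathcal W_2&\mathcal W_3\end{bmatrix}$ according to $\delta=(x_0,\mathbf w)$. Let $\bar\mu^*_{\mathrm{PWB}}$ be the least $\mu$ for which there is a causal linear control sequence $\mathbf u=\Phi_u\delta$ ($\Phi_u$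 block lower triangular, i.e. $u_k$ depends on $x_0,w_0,\dots,w_{k-1}$) with $$J(\delta,\mathbf u)-J^*(\delta)\le\mu\,\delta^\top\mathcal W_w\delta\qquad\text{for all }\mathbf w\in\mathbb W^T .$$ A system response is a matrix $\Phi=\begin{bmatrix}\Phi_x\\ \Phi_u\end{bmatrix}=[\Phi_0\ \ \Phi_w]$ with block lower triangular $\Phi_x,\Phi_u$ and $[\,I-\mathcal Z\mathcal A\ \ -\mathcal Z\mathcal B\,]\Phi=\mathcal E$. For $s\in\mathbb R$ and a symmetric matrix $\Lambda$ let $$M(\mu,s,\Lambda,\Phi)=\begin{bmatrix}x_0^\top(\mathcal O_1+\mu\mathcal W_1)x_0-s& x_0^\top(\mathcal O_2^\top+\mu\mathcal W_2^\top)&x_0^\top\Phi_0^\top\mathcal C^{1/2}\\(\mathcal O_2+\mu\mathcal W_2)x_0&\Lambda+\mathcal O_3+\mu\mathcal W_3&\Phi_w^\top\mathcal C^{1/2}\\ \mathcal C^{1/2}\Phi_0x_0&\mathcal C^{1/2}\Phi_w&I\end{bmatrix}.$$ Let $\mu^*$ be the optimal value of the bounded-energy semi-definite program: minimise $\mu$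 over $\mu\in\mathbb R$, $\lambda\ge0$ and system responses $\Phi$ subject to $M(\mu,\lambda\omega,\lambda I,\Phi)\succeq0$, with energy bound $\omega=T/\sigma_{\min}(P)$. Let $\bar\mu^*$ be the optimal value of the pointwise semi-definite program: minimise $\mu$ over $\mu\in\mathbb R$, $\bar\lambda_1,\dots,\bar\lambda_T\ge0$ and system responses $\Phi$ subject to $M(\mu,\sum_i\bar\lambda_i,\sum_i\bar\lambda_i\mathcal P_i,\Phi)\succeq0$, where $\mathcal P_i$ has $P$ as its $i$-th diagonal block and zeros elsewhere. Then the three minima exist and $$\frac{2}{\pi\,\kappa(\mathcal W_w)}\,\bar\mu^*\ \le\ \bar\mu^*_{\mathrm{PWB}}\ \le\ \bar\mu^*\ \le\ \mu^* .$$ Moreover, if $p=n$, then $\bar\mu^*_{\mathrm{PWB}}$ is also the least level that is attained by causal state feedback $\mathbf u=\mathcal K\mathbf x$ with $\mathcal K$ block lower triangular. -/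

import Mathlib

open scoped Matrix MatrixOrder

noncomputable section

namespace GenRegret

/-- Index set of the stacked state sequence `𝐱 = (x_0, …, x_T)`: `(i, k)` is component `i` of `x_k`. -/
abbrev StateIdx (T n : ℕ) := Fin n × Fin (T + 1)

/-- Index set of the stacked input sequence `𝐮 = (u_0, …, u_T)`. -/
abbrev InputIdx (T m : ℕ) := Fin m × Fin (T + 1)

/-- Index set of the stacked disturbance sequence `𝐰 = (w_0, …, w_{T-1})`. -/
abbrev DistIdx (T p : ℕ) := Fin p × Fin T

/-- Index set of `δ = (x_0, 𝐰)`. -/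
abbrev DeltaIdx (T n p : ℕ) := Fin n ⊕ DistIdx T p

/-- The data of the finite-horizon linear-quadratic problem: the dynamics
`x_{k+1} = A_k x_k + B_k u_k + E_k w_k` and the stage cost matrices `Q_k`, `R_k`. -/
structure LQData (T n m p : ℕ) where
  A : Fin (T + 1) → Matrix (Fin n) (Fin n) ℝ
  B : Fin (T + 1) → Matrix (Fin n) (Fin m) ℝ
  E : Fin T → Matrix (Fin n) (Fin p) ℝ
  Q : Fin (T + 1) → Matrix (Fin n) (Fin n) ℝ
  R : Fin (T + 1) → Matrix (Fin m) (Fin m) ℝ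

section General

/-- Largest singular value of a square matrix. -/
def sigmaMax {ι : Type*} [Fintype ι] [DecidableEq ι] (M : Matrix ι ι ℝ) : ℝ :=
  (Matrix.toEuclideanLin M).singularValues 0

/-- Smallest singular value of a square matrix (singular values are listed in decreasing order,
starting with index `0`). -/
def sigmaMin {ι : Type*} [Fintype ι] [DecidableEq ι] (M : Matrix ι ι ℝ) : ℝ :=
  (Matrix.toEuclideanLin M).singularValues (Fintype.card ι - 1)

/-- The condition number `κ(M) = σ_max(M) / σ_min(M)`. -/
def condNumber {ι : Type*} [Fintype ι] [DecidableEq ι] (M : Matrix ι ι ℝ) : ℝ :=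
  sigmaMax M / sigmaMin M

end General

variable {T n m p : ℕ}

/-- The stacked vector `δ = (x_0, w_0, …, w_{T-1})`. -/
def delta (x0 : Fin n → ℝ) (w : Fin T → Fin p → ℝ) : DeltaIdx T n p → ℝ :=
  Sum.elim x0 (fun jk => w jk.2 jk.1)

/-- The block number of a component of `δ`: `x_0` is block `0` and `w_k` is block `k + 1`, so that
`x_k` depends on the blocks `0, …, k` only. -/
def deltaBlock : DeltaIdx T n p → ℕ :=
  Sum.elim (fun _ => 0) (fun jk => (jk.2 : ℕ) + 1)

/-- A matrix acting on `δ` with values in stacked sequences indexed by `k = 0, …, T` is causal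
if it is block lower triangular. -/
def IsCausalDelta {r : ℕ} (M : Matrix (Fin r × Fin (T + 1)) (DeltaIdx T n p) ℝ) : Prop :=
  ∀ (ik : Fin r × Fin (T + 1)) (d : DeltaIdx T n p), (ik.2 : ℕ) < deltaBlock d → M ik d = 0

/-- A controller matrix `𝒦`, acting as `𝐮 = 𝒦 𝐱`, is causal if it is block lower triangular. -/
def IsCausalState (K : Matrix (InputIdx T m) (StateIdx T n) ℝ) : Prop :=
  ∀ (ik : InputIdx T m) (jl : StateIdx T n), ik.2 < jl.2 → K ik jl = 0

/-- The pointwise disturbance bound `w_k ∈ 𝕎 = {w | wᵀ P w ≤ 1}` for all `k`. -/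
def PointwiseBounded (P : Matrix (Fin p) (Fin p) ℝ) (w : Fin T → Fin p → ℝ) : Prop :=
  ∀ k, w k ⬝ᵥ P *ᵥ w k ≤ 1

namespace LQData

variable (S : LQData T n m p)

/-- The state sequence generated by the dynamics. -/
def state (x0 : Fin n → ℝ) (u : Fin (T + 1) → Fin m → ℝ) (w : Fin T → Fin p → ℝ)
    (k : Fin (T + 1)) : Fin n → ℝ :=
  Fin.induction (motive := fun _ => Fin n → ℝ) x0
    (fun j x => S.A j.castSucc *ᵥ x + S.B j.castSucc *ᵥ u j.castSucc + S.E j *ᵥ w j) k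

/-- The cumulative cost `J`. -/
def cost (x0 : Fin n → ℝ) (u : Fin (T + 1) → Fin m → ℝ) (w : Fin T → Fin p → ℝ) : ℝ :=
  ∑ k, (S.state x0 u w k ⬝ᵥ S.Q k *ᵥ S.state x0 u w k + u k ⬝ᵥ S.R k *ᵥ u k)

/-- The optimal non-causal cost `J^*`: the least cost over all input sequences, chosen with
knowledge of the initial state and of the whole disturbance sequence. -/
def optCost (x0 : Fin n → ℝ) (w : Fin T → Fin p → ℝ) : ℝ :=
  ⨅ u : Fin (T + 1) → Fin m → ℝ, S.cost x0 u w

/-- The regret inequality `J - J^* ≤ μ δᵀ W δ` for one input and one disturbance sequence. -/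
def RegretLE (W : Matrix (DeltaIdx T n p) (DeltaIdx T n p) ℝ) (x0 : Fin n → ℝ) (μ : ℝ)
    (u : Fin (T + 1) → Fin m → ℝ) (w : Fin T → Fin p → ℝ) : Prop :=
  S.cost x0 u w - S.optCost x0 w ≤ μ * (delta x0 w ⬝ᵥ W *ᵥ delta x0 w)

/-- The generalised regret levels that are guaranteed, for all pointwise bounded disturbances, by
some causal linear control sequence `𝐮 = Φ_u δ`. -/
def pwbLevels (W : Matrix (DeltaIdx T n p) (DeltaIdx T n p) ℝ) (P : Matrix (Fin p) (Fin p) ℝ)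
    (x0 : Fin n → ℝ) : Set ℝ :=
  {μ | ∃ Φu : Matrix (InputIdx T m) (DeltaIdx T n p) ℝ, IsCausalDelta Φu ∧
    ∀ w : Fin T → Fin p → ℝ, PointwiseBounded P w →
      S.RegretLE W x0 μ (fun k i => (Φu *ᵥ delta x0 w) (i, k)) w}

/-- The generalised regret levels that are guaranteed, for all pointwise bounded disturbances, by
some causal linear state feedback `𝐮 = 𝒦 𝐱`. -/
def pwbFeedbackLevels (W : Matrix (DeltaIdx T n p) (DeltaIdx T n p) ℝ)
    (P : Matrix (Fin p) (Fin p) ℝ) (x0 : Fin n → ℝ) : Set ℝ :=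
  {μ | ∃ K : Matrix (InputIdx T m) (StateIdx T n) ℝ, IsCausalState K ∧
    ∀ w : Fin T → Fin p → ℝ, PointwiseBounded P w →
      ∃ u : Fin (T + 1) → Fin m → ℝ,
        (∀ i k, u k i = (K *ᵥ fun jl : StateIdx T n => S.state x0 u w jl.2 jl.1) (i, k)) ∧
        S.RegretLE W x0 μ u w}

/-- The downshift operator `𝒵`. -/
def shift : Matrix (StateIdx T n) (StateIdx T n) ℝ :=
  Matrix.of fun ik jl => if (ik.2 : ℕ) = jl.2 + 1 ∧ ik.1 = jl.1 then 1 else 0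

/-- `𝒜 = blkdiag(A_0, …, A_T)`. -/
def calA : Matrix (StateIdx T n) (StateIdx T n) ℝ := Matrix.blockDiagonal S.A

/-- `ℬ = blkdiag(B_0, …, B_T)`. -/
def calB : Matrix (StateIdx T n) (InputIdx T m) ℝ := Matrix.blockDiagonal S.B

/-- `ℰ = blkdiag(I, E_0, …, E_{T-1})`. -/
def calE : Matrix (StateIdx T n) (DeltaIdx T n p) ℝ :=
  Matrix.fromCols
    (Matrix.of fun ik j => if ik.2 = 0 ∧ ik.1 = j then 1 else 0)
    (Matrix.of fun ik jl => if ik.2 = jl.2.succ then S.E jl.2 ik.1 jl.1 else 0)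

/-- `𝒬 = blkdiag(Q_0, …, Q_T)`. -/
def calQ : Matrix (StateIdx T n) (StateIdx T n) ℝ := Matrix.blockDiagonal S.Q

/-- `ℛ = blkdiag(R_0, …, R_T)`. -/
def calR : Matrix (InputIdx T m) (InputIdx T m) ℝ := Matrix.blockDiagonal S.R

/-- `𝒞 = blkdiag(𝒬, ℛ)`. -/
def calC : Matrix (StateIdx T n ⊕ InputIdx T m) (StateIdx T n ⊕ InputIdx T m) ℝ :=
  Matrix.fromBlocks S.calQ 0 0 S.calR

/-- The operator `F` in `𝐱 = F 𝐮 + G δ`. -/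
def opF : Matrix (StateIdx T n) (InputIdx T m) ℝ := (1 - shift * S.calA)⁻¹ * shift * S.calB

/-- The operator `G` in `𝐱 = F 𝐮 + G δ`. -/
def opG : Matrix (StateIdx T n) (DeltaIdx T n p) ℝ := (1 - shift * S.calA)⁻¹ * S.calE

/-- The matrix `𝒪 = Gᵀ 𝒬 (I + F ℛ⁻¹ Fᵀ 𝒬)⁻¹ G` of the optimal non-causal cost. -/
def calO : Matrix (DeltaIdx T n p) (DeltaIdx T n p) ℝ :=
  S.opGᵀ * S.calQ * (1 + S.opF * S.calR⁻¹ * S.opFᵀ * S.calQ)⁻¹ * S.opG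

/-- `Φ = (Φ_x; Φ_u)` is a system response: `Φ_x` and `Φ_u` are causal and
`[I - 𝒵𝒜, -𝒵ℬ] Φ = ℰ`. -/
def IsSystemResponse (Φ : Matrix (StateIdx T n ⊕ InputIdx T m) (DeltaIdx T n p) ℝ) : Prop :=
  IsCausalDelta Φ.toRows₁ ∧ IsCausalDelta Φ.toRows₂ ∧
    Matrix.fromCols (1 - shift * S.calA) (-(shift * S.calB)) * Φ = S.calE

/-- The matrix of the linear matrix inequality, for a multiplier with offset `s` and quadratic
part `Λ`; here `Φ = [Φ_0, Φ_w]` and `𝒪 = [𝒪_1, 𝒪_2ᵀ; 𝒪_2, 𝒪_3]`, `W = [W_1, W_2ᵀ; W_2, W_3]`. -/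
def lmiMatrix (W : Matrix (DeltaIdx T n p) (DeltaIdx T n p) ℝ) (x0 : Fin n → ℝ)
    (μ s : ℝ) (Λ : Matrix (DistIdx T p) (DistIdx T p) ℝ)
    (Φ : Matrix (StateIdx T n ⊕ InputIdx T m) (DeltaIdx T n p) ℝ) :
    Matrix (Unit ⊕ (DistIdx T p ⊕ (StateIdx T n ⊕ InputIdx T m)))
      (Unit ⊕ (DistIdx T p ⊕ (StateIdx T n ⊕ InputIdx T m))) ℝ :=
  let X : Matrix (Fin n) Unit ℝ := Matrix.replicateCol Unit x0
  let O₁ := S.calO.toBlocks₁₁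
  let O₂ := S.calO.toBlocks₂₁
  let O₃ := S.calO.toBlocks₂₂
  let W₁ := W.toBlocks₁₁
  let W₂ := W.toBlocks₂₁
  let W₃ := W.toBlocks₂₂
  let Φ₀ := Φ.toCols₁
  let Φw := Φ.toCols₂
  let Ch := CFC.sqrt S.calC
  Matrix.fromBlocks
    (Xᵀ * (O₁ + μ • W₁) * X - s • (1 : Matrix Unit Unit ℝ))
    (Matrix.fromCols (Xᵀ * (O₂ᵀ + μ • W₂ᵀ)) (Xᵀ * Φ₀ᵀ * Ch))
    (Matrix.fromRows ((O₂ + μ • W₂) * X) (Ch * Φ₀ * X))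
    (Matrix.fromBlocks (Λ + O₃ + μ • W₃) (Φwᵀ * Ch) (Ch * Φw) 1)

/-- Objective values of the feasible points of the semi-definite program for the disturbance energy
bound `𝐰ᵀ 𝐰 ≤ ω`, with decision variables `μ`, `lam`, `Φ`. -/
def energySDP (W : Matrix (DeltaIdx T n p) (DeltaIdx T n p) ℝ) (ω : ℝ) (x0 : Fin n → ℝ) :
    Set ℝ :=
  {μ | ∃ (lam : ℝ) (Φ : Matrix (StateIdx T n ⊕ InputIdx T m) (DeltaIdx T n p) ℝ),
    0 ≤ lam ∧ S.IsSystemResponse Φ ∧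
    (S.lmiMatrix W x0 μ (lam * ω) (lam • (1 : Matrix (DistIdx T p) (DistIdx T p) ℝ)) Φ).PosSemidef}

/-- `𝒫_i`, with `P` as its `i`-th diagonal block and zeros elsewhere. -/
def calP (P : Matrix (Fin p) (Fin p) ℝ) (i : Fin T) : Matrix (DistIdx T p) (DistIdx T p) ℝ :=
  Matrix.blockDiagonal (Pi.single i P)

/-- Objective values of the feasible points of the semi-definite program for pointwise bounded
disturbances, with decision variables `μ`, `lam i`, `Φ`. -/
def pointwiseSDP (W : Matrix (DeltaIdx T n p) (DeltaIdx T n p) ℝ) (P : Matrix (Fin p) (Fin p) ℝ)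
    (x0 : Fin n → ℝ) : Set ℝ :=
  {μ | ∃ (lam : Fin T → ℝ) (Φ : Matrix (StateIdx T n ⊕ InputIdx T m) (DeltaIdx T n p) ℝ),
    (∀ i, 0 ≤ lam i) ∧ S.IsSystemResponse Φ ∧
    (S.lmiMatrix W x0 μ (∑ i, lam i) (∑ i, lam i • calP P i) Φ).PosSemidef}

end LQData

end GenRegret

end

/-!
# Generalised regret for pointwise bounded disturbances

Write `δ_t = (t x_0, 𝐰) = L z` with `z = (t, 𝐰)` and `L = diag (x_0, I)` (`lift`). A causal `Φ_u`
enters all four problems only through `Ψ = Φ_u L`, and the admissible `Ψ` form a linear subspace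
(`responses`). Completing squares shows `J^* = δᵀ 𝒪 δ` (`optCost_eq`), so `J - J^*` is a positive
semidefinite form `N(Ψ)` in `z` (`regretMatrix`). The Schur complement of the identity block turns
the linear matrix inequality into `μ Lᵀ W L - N(Ψ) + diag (-s, Λ) ⪰ 0`
(`posSemidef_lmiMatrix_iff`).

*Upper bounds.* A multiplier `∑ lam_i (w_iᵀ P w_i - t²)` is nonpositive at `t = 1` on pointwise
bounded disturbances, so the pointwise program is feasible only at guaranteed regret levels. As
`P ⪰ σ_min(P) I`, an energy multiplier `lam` is dominated by `lam_i = lam / σ_min(P)`.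

*Attainment.* Nonzero admissible disturbances force `μ ≥ 0`. A bound on `μ` bounds `Ψ z` for finitely
many vectors `z` spanning the space because `ℛ ≻ 0`, and it bounds the multipliers through the entry
at `t = 1`, `𝐰 = 0`. Each set of levels is thus the projection of a closed set with compact
sublevel sets.

*Lower bound.* After diagonalising `P`, a level `μ` of pointwise bounded regret gives
`zᵀ N z ≤ μ σ_max(W) |L z|²` on a product of ellipsoids with diagonal matrices. If no multiplier
existed for `π / 2 * κ(W) * μ + ε`, separation would give a positive semidefinite `X` that violates
the dual bound (`exists_multiplier`). Rounding a Gaussian vector `g` with covariance `X` to the signs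
`z_a = ± √X_aa` keeps the block constraints and the right-hand side unchanged, since all of
them are diagonal. Expanding `(z - α g)ᵀ N (z - α g) ≥ 0` with `α = √(2 / π)` shows
`E zᵀ N z ≥ 2 / π * tr (N X)` (`two_div_pi_mul_trace_le`), a contradiction. This argument
requires `x_0 ≠ 0`; for `x_0 = 0` the regret is homogeneous in `𝐰` and no multiplier is needed.

*Feedback.* For invertible `E_k` the disturbance is a causal function of states and inputs, so causal
state feedback and causal disturbance feedback produce the same closed loops
(`pwbFeedbackLevels_eq`).
-/

noncomputable section

namespace GenRegret

/-! ### Causal matrices and singular values -/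

section Causal

variable {ι κ ν : Type*}

/-- `M` is causal (block lower triangular) for the block numbers `b` of its rows and `c` of its
columns. -/
def Causal (b : ι → ℕ) (c : κ → ℕ) (M : Matrix ι κ ℝ) : Prop :=
  ∀ i j, b i < c j → M i j = 0

/-- `M` is strictly causal (block strictly lower triangular). -/
def StrictlyCausal (b : ι → ℕ) (c : κ → ℕ) (M : Matrix ι κ ℝ) : Prop :=
  ∀ i j, b i ≤ c j → M i j = 0

variable {b : ι → ℕ} {c : κ → ℕ} {d : ν → ℕ}

lemma StrictlyCausal.causal {M : Matrix ι κ ℝ} (h : StrictlyCausal b c M) : Causal b c M :=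
  fun i j hij => h i j hij.le

lemma Causal.add {M N : Matrix ι κ ℝ} (hM : Causal b c M) (hN : Causal b c N) :
    Causal b c (M + N) := fun i j h => by simp [hM i j h, hN i j h]

lemma Causal.sub {M N : Matrix ι κ ℝ} (hM : Causal b c M) (hN : Causal b c N) :
    Causal b c (M - N) := fun i j h => by simp [hM i j h, hN i j h]

lemma StrictlyCausal.neg {M : Matrix ι κ ℝ} (hM : StrictlyCausal b c M) :
    StrictlyCausal b c (-M) := fun i j h => by simp [hM i j h]

lemma Causal.one [DecidableEq ι] : Causal b b (1 : Matrix ι ι ℝ) := fun i j h => by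
  rw [Matrix.one_apply_ne]
  rintro rfl
  exact lt_irrefl _ h

variable [Fintype κ]

lemma Causal.mul {M : Matrix ι κ ℝ} {N : Matrix κ ν ℝ} (hM : Causal b c M) (hN : Causal c d N) :
    Causal b d (M * N) := fun i j h => by
  refine Finset.sum_eq_zero fun k _ => ?_
  rcases lt_or_ge (b i) (c k) with hk | hk
  · simp [hM i k hk]
  · simp [hN k j (hk.trans_lt h)]

lemma Causal.mul_strictly {M : Matrix ι κ ℝ} {N : Matrix κ ν ℝ} (hM : Causal b c M)
    (hN : StrictlyCausal c d N) : StrictlyCausal b d (M * N) := fun i j h => by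
  refine Finset.sum_eq_zero fun k _ => ?_
  rcases lt_or_ge (b i) (c k) with hk | hk
  · simp [hM i k hk]
  · simp [hN k j (hk.trans h)]

lemma StrictlyCausal.mul {M : Matrix ι κ ℝ} {N : Matrix κ ν ℝ} (hM : StrictlyCausal b c M)
    (hN : Causal c d N) : StrictlyCausal b d (M * N) := fun i j h => by
  refine Finset.sum_eq_zero fun k _ => ?_
  rcases le_or_gt (b i) (c k) with hk | hk
  · simp [hM i k hk]
  · simp [hN k j (hk.trans_le h)]

variable [Fintype ι] [DecidableEq ι]

/-- The kernel of `1 - N` is trivial: a vector with `v = N v` vanishes block by block. -/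
lemma StrictlyCausal.isUnit_one_sub {N : Matrix ι ι ℝ} (hN : StrictlyCausal b b N) :
    IsUnit (1 - N) := by
  rw [← Matrix.mulVec_injective_iff_isUnit]
  refine (injective_iff_map_eq_zero (Matrix.mulVecLin (1 - N))).2 fun v hv => ?_
  have hv' : v = N *ᵥ v := by
    have : (1 - N) *ᵥ v = 0 := hv
    rwa [Matrix.sub_mulVec, Matrix.one_mulVec, sub_eq_zero] at this
  have key : ∀ k, ∀ i, b i = k → v i = 0 := by
    intro k
    induction k using Nat.strong_induction_on with
    | _ k ih =>
      rintro i rfl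
      rw [hv']
      refine Finset.sum_eq_zero fun j _ => ?_
      rcases le_or_gt (b i) (b j) with h | h
      · simp [hN i j h]
      · simp [ih _ h j rfl]
  exact funext fun i => key _ i rfl

/-- `(1 - N)⁻¹ = 1 + N (1 - N)⁻¹` determines `(1 - N)⁻¹` recursively along the blocks of rows. -/
lemma StrictlyCausal.causal_inv_one_sub {N : Matrix ι ι ℝ} (hN : StrictlyCausal b b N) :
    Causal b b (1 - N)⁻¹ := by
  have hu := (Matrix.isUnit_iff_isUnit_det _).1 hN.isUnit_one_sub
  have h1 : (1 - N)⁻¹ = 1 + N * (1 - N)⁻¹ := by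
    have := Matrix.mul_nonsing_inv (1 - N) hu
    rw [Matrix.sub_mul, Matrix.one_mul, sub_eq_iff_eq_add] at this
    exact this
  have key : ∀ k, ∀ i, b i = k → ∀ j, b i < b j → (1 - N)⁻¹ i j = 0 := by
    intro k
    induction k using Nat.strong_induction_on with
    | _ k ih =>
      rintro i rfl j hj
      rw [h1, Matrix.add_apply, Causal.one i j hj, zero_add]
      refine Finset.sum_eq_zero fun l _ => ?_
      rcases le_or_gt (b i) (b l) with h | h
      · simp [hN i l h]
      · simp [ih _ h l rfl j (h.trans hj)]
  exact fun i j h => key _ i rfl j h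

end Causal

section SingularValues

variable {ι : Type*} [Fintype ι] [DecidableEq ι]

/-- For `M ⪰ 0` every eigenvalue is a singular value, hence lies between the extreme ones. -/
lemma sigma_le_eigenvalues_le {M : Matrix ι ι ℝ} (hM : M.PosSemidef) (i : ι) :
    sigmaMin M ≤ hM.1.eigenvalues i ∧ hM.1.eigenvalues i ≤ sigmaMax M := by
  set T := Matrix.toEuclideanLin M with hT
  set v := hM.1.eigenvectorBasis i with hv
  have hadj : LinearMap.adjoint T = T := by
    rw [hT, ← Matrix.toEuclideanLin_conjTranspose_eq_adjoint, hM.1.eq]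
  have hTv : T v = hM.1.eigenvalues i • v := by
    ext j
    have := congrFun (hM.1.mulVec_eigenvectorBasis i) j
    simpa [hT, Matrix.toEuclideanLin, Matrix.toLpLin_apply] using this
  have hev : Module.End.HasEigenvalue (LinearMap.adjoint T ∘ₗ T) (hM.1.eigenvalues i ^ 2) := by
    refine Module.End.hasEigenvalue_of_hasEigenvector (x := v)
      ⟨Module.End.mem_eigenspace_iff.2 ?_, ?_⟩
    · rw [hadj, LinearMap.comp_apply, hTv, map_smul, hTv, smul_smul, sq]
    · exact hM.1.eigenvectorBasis.orthonormal.ne_zero i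
  have hn : Module.finrank ℝ (EuclideanSpace ℝ ι) = Fintype.card ι := by simp
  obtain ⟨k, hk⟩ := T.isSymmetric_adjoint_comp_self.exists_eigenvalues_eq hn hev
  have hk' : T.singularValues k = hM.1.eigenvalues i := by
    rw [T.singularValues_fin hn, show T.isSymmetric_adjoint_comp_self.eigenvalues hn k
      = hM.1.eigenvalues i ^ 2 from by exact_mod_cast hk, Real.sqrt_sq (hM.eigenvalues_nonneg i)]
  rw [← hk']
  exact ⟨T.singularValues_antitone (by have := k.2; omega), T.singularValues_antitone (by simp)⟩

lemma exists_orthogonal_diagonalization {M : Matrix ι ι ℝ} (hM : M.IsHermitian) :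
    ∃ U : Matrix ι ι ℝ, Uᵀ * U = 1 ∧ U * Uᵀ = 1 ∧
      M = U * Matrix.diagonal hM.eigenvalues * Uᵀ := by
  refine ⟨hM.eigenvectorUnitary, ?_, ?_, ?_⟩
  · exact (Matrix.mem_unitaryGroup_iff').1 hM.eigenvectorUnitary.2
  · exact (Matrix.mem_unitaryGroup_iff).1 hM.eigenvectorUnitary.2
  · conv_lhs => rw [hM.spectral_theorem]
    rw [Unitary.conjStarAlgAut_apply]
    rfl

lemma posSemidef_sub_sigmaMin {M : Matrix ι ι ℝ} (hM : M.PosSemidef) :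
    (M - sigmaMin M • (1 : Matrix ι ι ℝ)).PosSemidef := by
  obtain ⟨U, -, hU, h⟩ := exists_orthogonal_diagonalization hM.1
  have : M - sigmaMin M • (1 : Matrix ι ι ℝ)
      = U * Matrix.diagonal (fun i => hM.1.eigenvalues i - sigmaMin M) * Uᴴ := by
    rw [← Matrix.diagonal_sub, Matrix.mul_sub, Matrix.sub_mul,
      Matrix.conjTranspose_eq_transpose_of_trivial, ← h, ← Matrix.smul_one_eq_diagonal,
      Matrix.mul_smul, Matrix.smul_mul, Matrix.mul_one, hU]
  rw [this]
  refine Matrix.PosSemidef.mul_mul_conjTranspose_same (Matrix.PosSemidef.diagonal fun i => ?_) _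
  exact sub_nonneg.2 (sigma_le_eigenvalues_le hM i).1

lemma posSemidef_sigmaMax_sub {M : Matrix ι ι ℝ} (hM : M.PosSemidef) :
    (sigmaMax M • (1 : Matrix ι ι ℝ) - M).PosSemidef := by
  obtain ⟨U, -, hU, h⟩ := exists_orthogonal_diagonalization hM.1
  have : sigmaMax M • (1 : Matrix ι ι ℝ) - M
      = U * Matrix.diagonal (fun i => sigmaMax M - hM.1.eigenvalues i) * Uᴴ := by
    rw [← Matrix.diagonal_sub, Matrix.mul_sub, Matrix.sub_mul,
      Matrix.conjTranspose_eq_transpose_of_trivial, ← h, ← Matrix.smul_one_eq_diagonal,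
      Matrix.mul_smul, Matrix.smul_mul, Matrix.mul_one, hU]
  rw [this]
  refine Matrix.PosSemidef.mul_mul_conjTranspose_same (Matrix.PosSemidef.diagonal fun i => ?_) _
  exact sub_nonneg.2 (sigma_le_eigenvalues_le hM i).2

lemma sigmaMin_pos [Nonempty ι] {M : Matrix ι ι ℝ} (hM : M.PosDef) : 0 < sigmaMin M := by
  have hn : Module.finrank ℝ (EuclideanSpace ℝ ι) = Fintype.card ι := by simp
  refine (LinearMap.injective_iff_forall_lt_finrank_singularValues_pos _).1 ?_ _ ?_
  · refine (injective_iff_map_eq_zero _).2 fun v hv => ?_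
    have h0 : M *ᵥ v.ofLp = 0 := by
      exact congrArg WithLp.ofLp hv
    have := (Matrix.mulVec_injective_iff_isUnit.2 hM.isUnit) (h0.trans (Matrix.mulVec_zero M).symm)
    ext i
    exact congrFun this i
  · rw [hn]; exact Nat.sub_lt Fintype.card_pos one_pos

lemma sigmaMin_le_sigmaMax (M : Matrix ι ι ℝ) : sigmaMin M ≤ sigmaMax M :=
  LinearMap.singularValues_antitone _ (Nat.zero_le _)

end SingularValues

/-! ### Rounding Gaussian vectors to signs -/

section Gauss

open MeasureTheory ProbabilityTheory

section Gaussian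

variable {E : Type*} [NormedAddCommGroup E] [InnerProductSpace ℝ E] [FiniteDimensional ℝ E]
  [MeasurableSpace E] [BorelSpace E]

/-- The sign of a real number, with the convention that the sign of `0` is `1`. -/
def sgn (x : ℝ) : ℝ := if 0 ≤ x then 1 else -1

lemma sgn_mul_self (x : ℝ) : sgn x * sgn x = 1 := by unfold sgn; split_ifs <;> norm_num

lemma sgn_mul_eq_abs (x : ℝ) : sgn x * x = |x| := by
  unfold sgn; split_ifs with h
  · rw [abs_of_nonneg h, one_mul]
  · rw [abs_of_neg (not_le.1 h)]; ring

lemma abs_sgn (x : ℝ) : |sgn x| = 1 := by unfold sgn; split_ifs <;> simp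

lemma measurable_sgn : Measurable sgn :=
  Measurable.ite measurableSet_Ici measurable_const measurable_const

lemma integral_abs_gaussianReal : ∫ x, |x| ∂(gaussianReal 0 1) = √(2 / Real.pi) := by
  rw [integral_gaussianReal_eq_integral_smul one_ne_zero]
  have h1 : ∀ x : ℝ, gaussianPDFReal 0 1 x • |x|
      = (fun y : ℝ => (√(2 * Real.pi))⁻¹ * (y ^ (1 : ℝ) * Real.exp (-(1 / 2) * y ^ (2 : ℝ)))) |x| := by
    intro x
    have : |x| ^ (2 : ℝ) = x ^ 2 := by rw [Real.rpow_two, sq_abs]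
    simp only [gaussianPDFReal, smul_eq_mul, Real.rpow_one, this]
    simp only [NNReal.coe_one, sub_zero, mul_one]
    rw [mul_assoc, mul_comm |x|]
    congr 3
    ring
  simp_rw [h1]
  rw [integral_comp_abs
    (f := fun y : ℝ => (√(2 * Real.pi))⁻¹ * (y ^ (1 : ℝ) * Real.exp (-(1 / 2) * y ^ (2 : ℝ)))),
    integral_const_mul, integral_rpow_mul_exp_neg_mul_rpow (by norm_num) (by norm_num) (by norm_num)]
  have : ((1 : ℝ) + 1) / 2 = 1 := by norm_num
  rw [this, Real.Gamma_one, neg_div, this, Real.rpow_neg_one]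
  rw [Real.sqrt_div (by norm_num), Real.sqrt_mul (by norm_num)]
  have h2 : √2 * √2 = (2 : ℝ) := Real.mul_self_sqrt (by norm_num)
  have h3 : √Real.pi ≠ 0 := (Real.sqrt_pos.2 Real.pi_pos).ne'
  have h4 : √(2 : ℝ) ≠ 0 := (Real.sqrt_pos.2 two_pos).ne'
  field_simp
  nlinarith

lemma integrable_inner_stdGaussian (v : E) : Integrable (fun ξ => inner ℝ v ξ) (stdGaussian E) :=
  IsGaussian.integrable_dual (stdGaussian E) (innerSL ℝ v)

lemma memLp_inner_stdGaussian (v : E) : MemLp (fun ξ => inner ℝ v ξ) 2 (stdGaussian E) :=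
  IsGaussian.memLp_dual (stdGaussian E) (innerSL ℝ v) 2 (by norm_num)

lemma integrable_inner_mul_inner_stdGaussian (u v : E) :
    Integrable (fun ξ => inner ℝ u ξ * inner ℝ v ξ) (stdGaussian E) :=
  (memLp_inner_stdGaussian u).integrable_mul (memLp_inner_stdGaussian v)

lemma integral_inner_mul_inner_stdGaussian (u v : E) :
    ∫ ξ, inner ℝ u ξ * inner ℝ v ξ ∂(stdGaussian E) = inner ℝ u v := by
  have h := covarianceBilin_apply (μ := stdGaussian E) IsGaussian.memLp_two_id u v
  rw [covarianceBilin_stdGaussian] at h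
  rw [integral_congr_ae (g := fun z => inner ℝ u (z - ∫ x, id x ∂stdGaussian E)
    * inner ℝ v (z - ∫ x, id x ∂stdGaussian E)) (Filter.Eventually.of_forall fun z => by simp), ← h]
  rfl

lemma integral_abs_inner_stdGaussian (v : E) :
    ∫ ξ, |inner ℝ v ξ| ∂(stdGaussian E) = √(2 / Real.pi) * ‖v‖ := by
  have h := IsGaussian.map_eq_gaussianReal (μ := stdGaussian E) (innerSL ℝ v)
  rw [integral_strongDual_stdGaussian, variance_dual_stdGaussian, innerSL_apply_norm] at h
  have h2 : gaussianReal 0 (‖v‖ ^ 2).toNNReal = (gaussianReal 0 1).map (fun x => ‖v‖ * x) := by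
    rw [gaussianReal_map_const_mul]
    congr 1
    · simp
    · ext; simp
  calc ∫ ξ, |inner ℝ v ξ| ∂(stdGaussian E)
      = ∫ x, |x| ∂((stdGaussian E).map (innerSL ℝ v)) := by
        rw [integral_map (by fun_prop) (by fun_prop)]; simp
    _ = ∫ x, ‖v‖ * |x| ∂(gaussianReal 0 1) := by
        rw [h, h2, integral_map (by fun_prop) (by fun_prop)]; simp [abs_mul]
    _ = _ := by rw [integral_const_mul, integral_abs_gaussianReal, mul_comm]

lemma integrable_sgn_inner_mul_inner (u v : E) :
    Integrable (fun ξ => sgn (inner ℝ v ξ) * inner ℝ u ξ) (stdGaussian E) := by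
  refine (integrable_inner_stdGaussian u).bdd_mul (c := 1) ?_ ?_
  · exact (measurable_sgn.comp (by fun_prop)).aestronglyMeasurable
  · exact Filter.Eventually.of_forall fun ξ => by simp [abs_sgn]

/-- A vector orthogonal to `v` contributes nothing, by reflection in `v`. -/
lemma integral_sgn_inner_mul_inner_of_orthogonal {u v : E} (h : inner ℝ v u = 0) :
    ∫ ξ, sgn (inner ℝ v ξ) * inner ℝ u ξ ∂(stdGaussian E) = 0 := by
  set f : E ≃ₗᵢ[ℝ] E := (ℝ ∙ v).reflection with hf
  have hv : f v = v := Submodule.reflection_mem_subspace_eq_self (Submodule.mem_span_singleton_self v)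
  have hu : f u = -u := Submodule.reflection_mem_subspace_orthogonalComplement_eq_neg
    (Submodule.mem_orthogonal_singleton_iff_inner_right.2 h)
  have hmap := stdGaussian_map (E := E) f
  have h1 : ∫ ξ, sgn (inner ℝ v ξ) * inner ℝ u ξ ∂(stdGaussian E)
      = ∫ ξ, sgn (inner ℝ v (f ξ)) * inner ℝ u (f ξ) ∂(stdGaussian E) := by
    conv_lhs => rw [← hmap]
    rw [integral_map f.continuous.aemeasurable]
    exact ((measurable_sgn.comp (by fun_prop)).mul (by fun_prop)).aestronglyMeasurable
  have h2 : ∀ ξ, sgn (inner ℝ v (f ξ)) * inner ℝ u (f ξ)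
      = -(sgn (inner ℝ v ξ) * inner ℝ u ξ) := fun ξ => by
    have e1 : inner ℝ v (f ξ) = inner ℝ v ξ := by
      conv_lhs => rw [← hv]
      exact f.inner_map_map v ξ
    have e2 : inner ℝ u (f ξ) = -inner ℝ u ξ := by
      conv_lhs => rw [← neg_neg u, inner_neg_left, ← hu, f.inner_map_map]
    rw [e1, e2, mul_neg]
  simp_rw [h2, integral_neg] at h1
  linarith

/-- The correlation between the sign of one Gaussian variable and another, by splitting `u` into its
components along and orthogonal to `v`. -/
lemma norm_mul_integral_sgn_inner_mul_inner (u v : E) :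
    ‖v‖ * ∫ ξ, sgn (inner ℝ v ξ) * inner ℝ u ξ ∂(stdGaussian E)
      = √(2 / Real.pi) * inner ℝ v u := by
  rcases eq_or_ne v 0 with rfl | hv
  · simp
  have hv2 : ‖v‖ ≠ 0 := norm_ne_zero_iff.2 hv
  set a : ℝ := inner ℝ v u / ‖v‖ ^ 2 with ha
  have horth : inner ℝ v (u - a • v) = 0 := by
    rw [inner_sub_right, inner_smul_right, real_inner_self_eq_norm_sq, ha]
    field_simp
    ring
  have h1 : ∀ ξ, sgn (inner ℝ v ξ) * inner ℝ u ξ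
      = sgn (inner ℝ v ξ) * inner ℝ (u - a • v) ξ + a * |inner ℝ v ξ| := fun ξ => by
    rw [inner_sub_left, real_inner_smul_left, ← sgn_mul_eq_abs]; ring
  simp_rw [h1]
  rw [integral_add (integrable_sgn_inner_mul_inner _ _)
    ((integrable_inner_stdGaussian v).abs.const_mul a),
    integral_sgn_inner_mul_inner_of_orthogonal horth, integral_const_mul,
    integral_abs_inner_stdGaussian, ha]
  field_simp
  ring

end Gaussian

section Rounding

variable {ι : Type*} [Fintype ι] [DecidableEq ι]

/-- **Rounding a positive semidefinite matrix to signs.** If `zᵀ N z ≤ K` for all vectors `z` with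
`z_a = ± √X_aa`, then the average `tr (N X)` of the quadratic form over the covariance `X` is at
most `π / 2 * K`. -/
theorem two_div_pi_mul_trace_le {N X : Matrix ι ι ℝ} (hN : N.PosSemidef) (hX : X.PosSemidef) {K : ℝ}
    (h : ∀ s : ι → ℝ, (∀ a, s a * s a = 1) →
      (fun a => √(X a a) * s a) ⬝ᵥ N *ᵥ (fun a => √(X a a) * s a) ≤ K) :
    2 / Real.pi * (N * X).trace ≤ K := by
  obtain ⟨V, hV⟩ := CStarAlgebra.nonneg_iff_eq_star_mul_self.1 hX.nonneg
  set v : ι → EuclideanSpace ℝ ι := fun a => WithLp.toLp 2 fun i => V i a with hv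
  have hXv : ∀ a b, X a b = inner ℝ (v a) (v b) := fun a b => by
    simp [hV, hv, Matrix.mul_apply, Matrix.star_apply, PiLp.inner_apply, mul_comm]
  have hnorm : ∀ a, √(X a a) = ‖v a‖ := fun a => by
    rw [hXv, real_inner_self_eq_norm_sq, Real.sqrt_sq (norm_nonneg _)]
  set α : ℝ := √(2 / Real.pi) with hα
  have hα2 : α * α = 2 / Real.pi := Real.mul_self_sqrt (by positivity)
  set μ := stdGaussian (EuclideanSpace ℝ ι)
  let z : EuclideanSpace ℝ ι → ι → ℝ := fun ξ a => √(X a a) * sgn (inner ℝ (v a) ξ)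
  let g : EuclideanSpace ℝ ι → ι → ℝ := fun ξ a => inner ℝ (v a) ξ
  have hz : ∀ ξ, z ξ ⬝ᵥ N *ᵥ z ξ ≤ K := fun ξ => h _ fun a => sgn_mul_self _
  have hzg_int : ∀ a b, Integrable (fun ξ => z ξ a * g ξ b) μ := fun a b => by
    have := (integrable_sgn_inner_mul_inner (v b) (v a)).const_mul √(X a a)
    simpa only [z, g, mul_assoc] using this
  have hzg : ∀ a b, ∫ ξ, z ξ a * g ξ b ∂μ = α * X a b := fun a b => by
    rw [hXv a b, ← norm_mul_integral_sgn_inner_mul_inner, ← integral_const_mul, ← hnorm]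
    simp only [z, g, mul_assoc, μ]
  have hgg_int : ∀ a b, Integrable (fun ξ => g ξ a * g ξ b) μ := fun a b =>
    integrable_inner_mul_inner_stdGaussian _ _
  have hgg : ∀ a b, ∫ ξ, g ξ a * g ξ b ∂μ = X a b := fun a b => by
    rw [hXv, ← integral_inner_mul_inner_stdGaussian]
  have hXsymm : ∀ a b, X b a = X a b := fun a b => by rw [hXv, hXv, real_inner_comm]
  let r : ι → ι → EuclideanSpace ℝ ι → ℝ := fun a b ξ =>
    N a b * (-(α * (z ξ a * g ξ b)) - α * (z ξ b * g ξ a) + α * α * (g ξ a * g ξ b))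
  have hr_int : ∀ a b, Integrable (r a b) μ := fun a b =>
    ((((hzg_int a b).const_mul α).neg.sub ((hzg_int b a).const_mul α)).add
      ((hgg_int a b).const_mul (α * α))).const_mul (N a b)
  have hr : ∀ a b, ∫ ξ, r a b ξ ∂μ = -(2 / Real.pi) * (N a b * X b a) := fun a b => by
    have i1 : Integrable (fun ξ => -(α * (z ξ a * g ξ b))) μ := ((hzg_int a b).const_mul α).neg
    have i2 : Integrable (fun ξ => α * (z ξ b * g ξ a)) μ := (hzg_int b a).const_mul α
    have i3 : Integrable (fun ξ => α * α * (g ξ a * g ξ b)) μ := (hgg_int a b).const_mul (α * α)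
    have i4 : Integrable (fun ξ => -(α * (z ξ a * g ξ b)) - α * (z ξ b * g ξ a)) μ := i1.sub i2
    simp only [r]
    rw [integral_const_mul, integral_add i4 i3, integral_sub i1 i2, integral_neg,
      integral_const_mul, integral_const_mul, integral_const_mul, hzg, hzg, hgg, ← hα2, hXsymm a b]
    ring
  -- `0 ≤ (z - α g)ᵀ N (z - α g)` for every outcome
  have hpt : ∀ ξ, 0 ≤ K + ∑ a, ∑ b, r a b ξ := fun ξ => by
    have h0 := hN.dotProduct_mulVec_nonneg (z ξ - α • g ξ)
    have h1 : star (z ξ - α • g ξ) ⬝ᵥ N *ᵥ (z ξ - α • g ξ)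
        = z ξ ⬝ᵥ N *ᵥ z ξ + ∑ a, ∑ b, r a b ξ := by
      simp only [dotProduct, Matrix.mulVec, Finset.mul_sum, ← Finset.sum_add_distrib, r]
      refine Finset.sum_congr rfl fun a _ => Finset.sum_congr rfl fun b _ => ?_
      simp only [star_trivial, Pi.sub_apply, Pi.smul_apply, smul_eq_mul]
      ring
    rw [h1] at h0
    linarith [hz ξ]
  have hint : 0 ≤ ∫ ξ, (K + ∑ a, ∑ b, r a b ξ) ∂μ := integral_nonneg hpt
  rw [integral_add (integrable_const _)
    (integrable_finsetSum _ fun a _ => integrable_finsetSum _ fun b _ => hr_int a b),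
    integral_finsetSum _ fun a _ => integrable_finsetSum _ fun b _ => hr_int a b] at hint
  simp_rw [integral_finsetSum _ fun b _ => hr_int _ b, hr, ← Finset.mul_sum] at hint
  have ht : (N * X).trace = ∑ a, ∑ b, N a b * X b a := rfl
  rw [ht]
  simp only [integral_const, probReal_univ, smul_eq_mul, one_mul] at hint
  linarith

end Rounding

end Gauss

/-! ### A semidefinite alternative and the approximate S-lemma -/

section Duality

variable {ι I : Type*} [Fintype ι]

lemma abs_dotProduct_mulVec_le {S : Matrix ι ι ℝ} {ε : ℝ} (hS : ∀ a b, |S a b| ≤ ε) (z : ι → ℝ) :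
    |z ⬝ᵥ S *ᵥ z| ≤ ε * Fintype.card ι * (z ⬝ᵥ z) := by
  have h1 : z ⬝ᵥ S *ᵥ z = ∑ a, ∑ b, z a * (S a b * z b) := by
    simp [dotProduct, Matrix.mulVec, Finset.mul_sum]
  have h2 : ∀ a b, |z a * (S a b * z b)| ≤ ε * ((z a * z a + z b * z b) / 2) := fun a b => by
    rw [abs_mul, abs_mul]
    have h3 : |z a| * |z b| ≤ (z a * z a + z b * z b) / 2 := by
      nlinarith [sq_nonneg (|z a| - |z b|), abs_mul_abs_self (z a), abs_mul_abs_self (z b)]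
    calc |z a| * (|S a b| * |z b|) = |S a b| * (|z a| * |z b|) := by ring
      _ ≤ ε * ((z a * z a + z b * z b) / 2) :=
        mul_le_mul (hS a b) h3 (by positivity) ((abs_nonneg _).trans (hS a b))
  calc |z ⬝ᵥ S *ᵥ z| ≤ ∑ a, ∑ b, |z a * (S a b * z b)| := by
        rw [h1]
        exact (Finset.abs_sum_le_sum_abs _ _).trans
          (Finset.sum_le_sum fun a _ => Finset.abs_sum_le_sum_abs _ _)
    _ ≤ ∑ a, ∑ b, ε * ((z a * z a + z b * z b) / 2) :=
        Finset.sum_le_sum fun a _ => Finset.sum_le_sum fun b _ => h2 a b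
    _ = _ := by
        simp_rw [← Finset.mul_sum, add_div, Finset.sum_add_distrib]
        simp only [Finset.sum_const, Finset.card_univ, nsmul_eq_mul, dotProduct, ← Finset.mul_sum,
          ← Finset.sum_div]
        ring

variable [DecidableEq ι] [Fintype I]

/-- **Semidefinite alternative.** If `tr (A X) > 0` for every nonzero positive semidefinite `X` with
`tr (D i X) ≤ 0` for all `i`, then some nonnegative combination of the `D i` makes
`A + ∑ i, lam i • D i` positive semidefinite. -/
theorem exists_multiplier {A : Matrix ι ι ℝ} {D : I → Matrix ι ι ℝ} (hA : A.IsHermitian)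
    (hD : ∀ i, (D i).IsHermitian)
    (h : ∀ X : Matrix ι ι ℝ, X.PosSemidef → X ≠ 0 → (∀ i, (D i * X).trace ≤ 0) →
      0 < (A * X).trace) :
    ∃ lam : I → ℝ, (∀ i, 0 ≤ lam i) ∧ (A + ∑ i, lam i • D i).PosSemidef := by
  by_contra hcon
  -- the matrices strictly below some `A + ∑ i, lam i • D i`, an open convex set
  set s : Set (Matrix ι ι ℝ) := {S | ∃ lam : I → ℝ, (∀ i, 0 ≤ lam i) ∧ ∃ ε > 0, ∀ z : ι → ℝ,
    ε * (z ⬝ᵥ z) ≤ z ⬝ᵥ (A + ∑ i, lam i • D i - S) *ᵥ z} with hs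
  have h0 : (0 : Matrix ι ι ℝ) ∉ s := by
    rintro ⟨lam, hlam, ε, hε, hz⟩
    refine hcon ⟨lam, hlam, .of_dotProduct_mulVec_nonneg ?_ fun z => ?_⟩
    · refine hA.add ?_
      simp only [Matrix.IsHermitian, Matrix.conjTranspose_sum, Matrix.conjTranspose_smul, (hD _).eq,
        star_trivial]
    · have := hz z
      rw [sub_zero] at this
      exact (mul_nonneg hε.le (by simpa using dotProduct_star_self_nonneg z)).trans this
  have hconv : Convex ℝ s := by
    rintro S ⟨l, hl, ε, hε, hS⟩ S' ⟨l', hl', ε', hε', hS'⟩ a b ha hb hab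
    refine ⟨a • l + b • l', fun i => add_nonneg (mul_nonneg ha (hl i)) (mul_nonneg hb (hl' i)),
      a * ε + b * ε', ?_, fun z => ?_⟩
    · rcases ha.eq_or_lt with rfl | ha
      · have : b = 1 := by linarith
        subst this; simpa using hε'
      · have := mul_pos ha hε
        have := mul_nonneg hb hε'.le
        positivity
    · have : A + ∑ i, (a • l + b • l') i • D i - (a • S + b • S')
          = a • (A + ∑ i, l i • D i - S) + b • (A + ∑ i, l' i • D i - S') := by
        have hA' : A = a • A + b • A := by rw [← add_smul, hab, one_smul]
        conv_lhs => rw [hA']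
        simp only [Pi.add_apply, Pi.smul_apply, smul_eq_mul, add_smul, Finset.sum_add_distrib,
          smul_sub, smul_add, Finset.smul_sum, mul_smul]
        abel
      rw [this, Matrix.add_mulVec, dotProduct_add, Matrix.smul_mulVec, Matrix.smul_mulVec,
        dotProduct_smul, dotProduct_smul, smul_eq_mul, smul_eq_mul]
      nlinarith [mul_le_mul_of_nonneg_left (hS z) ha, mul_le_mul_of_nonneg_left (hS' z) hb]
  have hopen : IsOpen s := by
    rw [isOpen_iff_mem_nhds]
    rintro S ⟨l, hl, ε, hε, hS⟩
    set c : ℝ := ε / (2 * (Fintype.card ι + 1)) with hc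
    have hc0 : 0 < c := by positivity
    have hcc : c * Fintype.card ι ≤ ε / 2 := by
      rw [hc, div_mul_eq_mul_div, div_le_div_iff₀ (by positivity) (by positivity)]
      nlinarith
    have hU : {S' : Matrix ι ι ℝ | ∀ a b, |S' a b - S a b| < c} ∈ nhds S := by
      refine IsOpen.mem_nhds ?_ fun a b => by simpa using hc0
      simp only [Set.ofPred_forall]
      refine isOpen_iInter_of_finite fun a => isOpen_iInter_of_finite fun b => ?_
      exact isOpen_lt ((((continuous_id.matrix_elem a b)).sub continuous_const).abs) continuous_const
    refine Filter.mem_of_superset hU fun S' hS' => ⟨l, hl, ε / 2, by positivity, fun z => ?_⟩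
    have h1 := (abs_le.1 (abs_dotProduct_mulVec_le (S := S' - S) (fun a b => (hS' a b).le) z)).2
    have h2 : A + ∑ i, l i • D i - S' = (A + ∑ i, l i • D i - S) - (S' - S) := by abel
    have h3 : 0 ≤ z ⬝ᵥ z := by simpa using dotProduct_star_self_nonneg z
    rw [h2, Matrix.sub_mulVec, dotProduct_sub]
    nlinarith [hS z, mul_le_mul_of_nonneg_right hcc h3]
  -- `f` separates; symmetrising its matrix gives the certificate `X`
  obtain ⟨f, hf⟩ := geometric_hahn_banach_open_point hconv hopen h0
  rw [map_zero] at hf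
  have hmem : ∀ (l : I → ℝ) (ε k : ℝ) (z : ι → ℝ), (∀ i, 0 ≤ l i) → 0 < ε → 0 ≤ k →
      f A + ∑ i, l i * f (D i) - ε * f 1 - k * f (Matrix.vecMulVec z z) < 0 := by
    intro l ε k z hl hε hk
    have := hf (A + ∑ i, l i • D i - ε • (1 : Matrix ι ι ℝ) - k • Matrix.vecMulVec z z)
      ⟨l, hl, ε, hε, fun y => ?_⟩
    · simpa [map_sub, map_add, map_sum, map_smul] using this
    · have e : A + ∑ i, l i • D i - (A + ∑ i, l i • D i - ε • (1 : Matrix ι ι ℝ)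
          - k • Matrix.vecMulVec z z) = ε • (1 : Matrix ι ι ℝ) + k • Matrix.vecMulVec z z := by abel
      rw [e, Matrix.add_mulVec, dotProduct_add, Matrix.smul_mulVec, Matrix.smul_mulVec,
        dotProduct_smul, dotProduct_smul, Matrix.one_mulVec, smul_eq_mul, smul_eq_mul,
        le_add_iff_nonneg_right]
      exact mul_nonneg hk
        ((Matrix.posSemidef_vecMulVec_self_star z).dotProduct_mulVec_nonneg y)
  have hlin : ∀ a b : ℝ, (∀ k : ℝ, 0 ≤ k → a + k * b < 0) → b ≤ 0 := fun a b hk => by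
    by_contra hb
    push Not at hb
    have := hk (|a| / b) (by positivity)
    rw [div_mul_cancel₀ _ hb.ne'] at this
    linarith [neg_abs_le a]
  have hfz : ∀ z, 0 ≤ f (Matrix.vecMulVec z z) := fun z => by
    have := hlin (f A - f 1) (-f (Matrix.vecMulVec z z)) fun k hk => by
      have := hmem 0 1 k z (fun i => le_rfl) one_pos hk
      simp at this; linarith
    linarith
  have hfD : ∀ i, f (D i) ≤ 0 := fun i => by
    classical
    refine hlin (f A - f 1) _ fun k hk => ?_
    have := hmem (Pi.single i k) 1 0 0 (fun j => by
      by_cases hj : j = i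
      · subst hj; simpa using hk
      · simp [hj]) one_pos le_rfl
    simp [Pi.single_apply] at this
    linarith
  have hfA : f A ≤ 0 := by
    have h1 : ∀ ε : ℝ, 0 < ε → f A - ε * f 1 < 0 := fun ε hε => by
      simpa using hmem 0 ε 0 0 (fun i => le_rfl) hε le_rfl
    by_contra hb
    push Not at hb
    have h2 := h1 (f A / (|f 1| + 1)) (by positivity)
    rw [div_mul_eq_mul_div, sub_neg, lt_div_iff₀ (by positivity)] at h2
    nlinarith [le_abs_self (f 1)]
  set X : Matrix ι ι ℝ := Matrix.of fun a b =>
    (f (Matrix.single a b 1) + f (Matrix.single b a 1)) / 2 with hX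
  have hfX : ∀ S : Matrix ι ι ℝ, S.IsHermitian → f S = (S * X).trace := by
    intro S hS
    have e1 : f S = ∑ a, ∑ b, S a b * f (Matrix.single a b 1) := by
      conv_lhs => rw [Matrix.matrix_eq_sum_single S]
      simp only [map_sum]
      refine Finset.sum_congr rfl fun a _ => Finset.sum_congr rfl fun b _ => ?_
      rw [← smul_eq_mul, ← map_smul, Matrix.smul_single, smul_eq_mul, mul_one]
    have e2 : f S = ∑ a, ∑ b, S a b * f (Matrix.single b a 1) := by
      rw [e1, Finset.sum_comm]
      refine Finset.sum_congr rfl fun a _ => Finset.sum_congr rfl fun b _ => ?_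
      rw [← hS.apply b a]; simp
    have e3 : (S * X).trace = ∑ a, ∑ b, S a b * X b a := rfl
    have e4 : ∑ a, ∑ b, S a b * X b a
        = (∑ a, ∑ b, S a b * f (Matrix.single a b 1)
          + ∑ a, ∑ b, S a b * f (Matrix.single b a 1)) / 2 := by
      simp only [hX, Matrix.of_apply, ← Finset.sum_add_distrib, Finset.sum_div]
      refine Finset.sum_congr rfl fun a _ => Finset.sum_congr rfl fun b _ => by ring
    rw [e3, e4, ← e1, ← e2]; ring
  have hXpsd : X.PosSemidef := by
    refine .of_dotProduct_mulVec_nonneg ?_ fun z => ?_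
    · ext a b; simp [hX, add_comm]
    · have hzz : (Matrix.vecMulVec z z).IsHermitian := (Matrix.posSemidef_vecMulVec_self_star z).1
      have := hfz z
      rw [hfX _ hzz, Matrix.vecMulVec_mul, Matrix.trace_vecMulVec, dotProduct_comm,
        ← Matrix.dotProduct_mulVec] at this
      exact this
  have hX0 : X ≠ 0 := by
    intro hX0
    have h1 := hmem 0 1 0 0 (fun i => le_rfl) one_pos le_rfl
    rw [hfX A hA, hfX 1 Matrix.isHermitian_one, hX0] at h1
    simp at h1
  have := h X hXpsd hX0 fun i => by rw [← hfX _ (hD i)]; exact hfD i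
  rw [← hfX A hA] at this
  linarith

variable {J : Type*} [Fintype J] [DecidableEq J] [DecidableEq I]

/-- The matrix of the form `(t, y) ↦ ∑ d_j y_j² - t²`, the sum being over the block `i`. -/
def blockConstraint (blk : J → I) (d : J → ℝ) (i : I) : Matrix (Unit ⊕ J) (Unit ⊕ J) ℝ :=
  Matrix.diagonal (Sum.elim (fun _ => -1) fun j => if blk j = i then d j else 0)

/-- **Approximate S-lemma.** If the form of `N ⪰ 0` is bounded by the diagonal form `q` whenever the
blocks of `y` lie in the ellipsoids `∑ d_j y_j² ≤ 1`, then `N` is bounded by `π / 2 • q` plus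
nonnegative multiples of the block constraints, up to an arbitrarily small diagonal term `e`. -/
theorem exists_multiplier_of_le_diagonal {N : Matrix (Unit ⊕ J) (Unit ⊕ J) ℝ} (hN : N.PosSemidef)
    (blk : J → I) {d : J → ℝ} (hd : ∀ j, 0 < d j) {q e : Unit ⊕ J → ℝ} (he : ∀ a, 0 < e a)
    (h : ∀ y : J → ℝ, (∀ i, ∑ j, (if blk j = i then d j else 0) * y j ^ 2 ≤ 1) →
      Sum.elim (fun _ => 1) y ⬝ᵥ N *ᵥ Sum.elim (fun _ => 1) y
        ≤ ∑ a, q a * (Sum.elim (fun _ => 1) y a : ℝ) ^ 2) :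
    ∃ lam : I → ℝ, (∀ i, 0 ≤ lam i) ∧
      (Matrix.diagonal (fun a => Real.pi / 2 * q a + e a) - N
        + ∑ i, lam i • blockConstraint blk d i).PosSemidef := by
  have htr : ∀ (c : Unit ⊕ J → ℝ) (X : Matrix (Unit ⊕ J) (Unit ⊕ J) ℝ),
      (Matrix.diagonal c * X).trace = ∑ a, c a * X a a := fun c X => by
    simp [Matrix.trace, Matrix.diagonal_mul]
  refine exists_multiplier ((Matrix.isHermitian_diagonal _).sub hN.1)
    (fun i => Matrix.isHermitian_diagonal _) fun X hX hX0 hD => ?_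
  have hdiag : ∀ a, 0 ≤ X a a := fun a => hX.diag_nonneg
  have hD' : ∀ i, ∑ j, (if blk j = i then d j else 0) * X (.inr j) (.inr j)
      ≤ X (.inl ()) (.inl ()) := fun i => by
    have := hD i
    rw [blockConstraint, htr, Fintype.sum_sum_type] at this
    simp only [Sum.elim_inl, Sum.elim_inr, Finset.univ_unique, Finset.sum_singleton] at this
    change -1 * X (.inl ()) (.inl ()) + _ ≤ 0 at this
    linarith
  have hX00 : 0 < X (.inl ()) (.inl ()) := by
    refine (hdiag _).lt_of_ne fun h0 => hX0 ?_
    rw [← hX.trace_eq_zero_iff, Matrix.trace]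
    refine Finset.sum_eq_zero fun a _ => ?_
    rcases a with u | j
    · exact h0.symm
    · have h1 := hD' (blk j)
      rw [← h0] at h1
      have h2 := Finset.single_le_sum (f := fun k => (if blk k = blk j then d k else 0)
        * X (.inr k) (.inr k)) (fun k _ => mul_nonneg (by split_ifs; exacts [(hd k).le, le_rfl])
          (hdiag _)) (Finset.mem_univ j)
      simp only [if_true] at h2
      have h3 := hdiag (.inr j)
      have h4 := hd j
      exact le_antisymm (by
        by_contra hc
        push Not at hc
        have : 0 < d j * X (.inr j) (.inr j) := mul_pos h4 hc
        linarith) h3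
  have key : 2 / Real.pi * (N * X).trace ≤ ∑ a, q a * X a a := by
    refine two_div_pi_mul_trace_le hN hX fun s hs => ?_
    -- `z` is `± √X_00` times an admissible vector `(1, y)`
    set z : Unit ⊕ J → ℝ := fun a => √(X a a) * s a with hz
    have hz2 : ∀ a, z a ^ 2 = X a a := fun a => by
      rw [hz]; simp only
      rw [mul_pow, Real.sq_sqrt (hdiag a), sq (s a), hs, mul_one]
    have hz0 : z (.inl ()) ≠ 0 := fun h0 => by
      have := hz2 (.inl ()); rw [h0] at this; simp at this; exact hX00.ne this
    set y : J → ℝ := fun j => z (.inr j) / z (.inl ()) with hy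
    have hzy : z = z (.inl ()) • Sum.elim (fun _ => 1) y := by
      ext a
      rcases a with u | j
      · simp
      · simp [hy, mul_div_cancel₀ _ hz0]
    have hyb := h y fun i => by
      have : ∀ j, y j ^ 2 = X (.inr j) (.inr j) / X (.inl ()) (.inl ()) := fun j => by
        rw [hy, div_pow, hz2, hz2]
      simp_rw [this, ← mul_div_assoc, ← Finset.sum_div]
      exact (div_le_one hX00).2 (hD' i)
    calc z ⬝ᵥ N *ᵥ z = z (.inl ()) ^ 2 *
          (Sum.elim (fun _ => 1) y ⬝ᵥ N *ᵥ Sum.elim (fun _ => 1) y) := by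
          conv_lhs => rw [hzy]
          rw [Matrix.mulVec_smul, smul_dotProduct, dotProduct_smul, smul_eq_mul, smul_eq_mul]
          ring
      _ ≤ z (.inl ()) ^ 2 * ∑ a, q a * (Sum.elim (fun _ => 1) y a : ℝ) ^ 2 :=
          mul_le_mul_of_nonneg_left hyb (sq_nonneg _)
      _ = ∑ a, q a * X a a := by
          rw [Finset.mul_sum]
          refine Finset.sum_congr rfl fun a _ => ?_
          have := congrFun hzy a
          rw [← hz2 a, this, Pi.smul_apply, smul_eq_mul]
          ring
  rw [Matrix.sub_mul, Matrix.trace_sub, htr]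
  have hpos : 0 < ∑ a, e a * X a a :=
    Finset.sum_pos' (fun a _ => mul_nonneg (he a).le (hdiag a))
      ⟨.inl (), Finset.mem_univ _, mul_pos (he _) hX00⟩
  have h5 : (N * X).trace ≤ Real.pi / 2 * ∑ a, q a * X a a := by
    have := mul_le_mul_of_nonneg_left key (by positivity : 0 ≤ Real.pi / 2)
    rwa [← mul_assoc, div_mul_div_cancel₀ (by norm_num), div_self Real.pi_ne_zero, one_mul] at this
  simp_rw [add_mul, Finset.sum_add_distrib, mul_assoc, ← Finset.mul_sum]
  linarith

end Duality

/-! ### The stacked dynamics and the optimal non-causal cost -/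

section BlockDiagonal

variable {α β γ : Type*} [Fintype β] [Fintype γ] [DecidableEq γ]

lemma blockDiagonal_mulVec_apply (M : γ → Matrix α β ℝ) (v : β × γ → ℝ) (i : α) (k : γ) :
    (Matrix.blockDiagonal M *ᵥ v) (i, k) = (M k *ᵥ fun j => v (j, k)) i := by
  simp [Matrix.mulVec, dotProduct, Fintype.sum_prod_type, Matrix.blockDiagonal_apply]

variable [Fintype α]

lemma dotProduct_blockDiagonal_mulVec (M : γ → Matrix α β ℝ) (u : α × γ → ℝ) (v : β × γ → ℝ) :
    u ⬝ᵥ Matrix.blockDiagonal M *ᵥ v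
      = ∑ k, (fun i => u (i, k)) ⬝ᵥ M k *ᵥ fun j => v (j, k) := by
  rw [dotProduct, Fintype.sum_prod_type_right]
  simp_rw [blockDiagonal_mulVec_apply]
  rfl

lemma posSemidef_blockDiagonal {M : γ → Matrix α α ℝ} (h : ∀ k, (M k).PosSemidef) :
    (Matrix.blockDiagonal M).PosSemidef := by
  refine .of_dotProduct_mulVec_nonneg ?_ fun v => ?_
  · rw [Matrix.IsHermitian, Matrix.blockDiagonal_conjTranspose]
    congr 1
    exact funext fun k => (h k).1.eq
  · rw [dotProduct_blockDiagonal_mulVec]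
    exact Finset.sum_nonneg fun k _ => (h k).dotProduct_mulVec_nonneg _

lemma posDef_blockDiagonal {M : γ → Matrix α α ℝ} (h : ∀ k, (M k).PosDef) :
    (Matrix.blockDiagonal M).PosDef := by
  refine .of_dotProduct_mulVec_pos (posSemidef_blockDiagonal fun k => (h k).posSemidef).1
    fun v hv => ?_
  rw [dotProduct_blockDiagonal_mulVec]
  obtain ⟨⟨i, k⟩, hik⟩ := Function.ne_iff.1 hv
  refine Finset.sum_pos' (fun k _ => (h k).posSemidef.dotProduct_mulVec_nonneg _)
    ⟨k, Finset.mem_univ _, (h k).dotProduct_mulVec_pos fun h0 => hik ?_⟩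
  exact congrFun h0 i

end BlockDiagonal

variable {T n m p : ℕ}

/-- The block number of a component of a stacked sequence indexed by `k = 0, …, T`. -/
def stageBlock {r : ℕ} (ik : Fin r × Fin (T + 1)) : ℕ := ik.2

/-- The stacked sequence `(v_0, …, v_T)`. -/
def stack {r : ℕ} (v : Fin (T + 1) → Fin r → ℝ) : Fin r × Fin (T + 1) → ℝ := fun ik => v ik.2 ik.1

namespace LQData

variable (S : LQData T n m p)

lemma state_zero (x0 : Fin n → ℝ) (u : Fin (T + 1) → Fin m → ℝ) (w : Fin T → Fin p → ℝ) :
    S.state x0 u w 0 = x0 := rfl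

lemma state_succ (x0 : Fin n → ℝ) (u : Fin (T + 1) → Fin m → ℝ) (w : Fin T → Fin p → ℝ)
    (j : Fin T) : S.state x0 u w j.succ = S.A j.castSucc *ᵥ S.state x0 u w j.castSucc
      + S.B j.castSucc *ᵥ u j.castSucc + S.E j *ᵥ w j := rfl

lemma shift_mulVec_zero (v : StateIdx T n → ℝ) (i : Fin n) : (shift *ᵥ v) (i, 0) = 0 := by
  simp [Matrix.mulVec, dotProduct, shift]

lemma shift_mulVec_succ (v : StateIdx T n → ℝ) (i : Fin n) (k : Fin T) :
    (shift *ᵥ v) (i, k.succ) = v (i, k.castSucc) := by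
  rw [Matrix.mulVec, dotProduct, Finset.sum_eq_single (i, k.castSucc)]
  · simp [shift]
  · rintro ⟨i', k'⟩ - hne
    have : ¬ ((k : ℕ) = k' ∧ i = i') := fun h => hne (Prod.ext h.2.symm (Fin.ext h.1.symm))
    simp [shift, this]
  · simp

lemma calE_mulVec_zero (x0 : Fin n → ℝ) (w : Fin T → Fin p → ℝ) (i : Fin n) :
    (S.calE *ᵥ delta x0 w) (i, 0) = x0 i := by
  simp [calE, delta, Matrix.mulVec, dotProduct, (Fin.succ_ne_zero _).symm]

lemma calE_mulVec_succ (x0 : Fin n → ℝ) (w : Fin T → Fin p → ℝ) (i : Fin n) (k : Fin T) :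
    (S.calE *ᵥ delta x0 w) (i, k.succ) = (S.E k *ᵥ w k) i := by
  simp [calE, delta, Matrix.mulVec, dotProduct, Fintype.sum_prod_type]

lemma strictlyCausal_shift :
    StrictlyCausal stageBlock stageBlock (shift : Matrix (StateIdx T n) (StateIdx T n) ℝ) := by
  intro ik jl h
  have : ¬ ((ik.2 : ℕ) = jl.2 + 1 ∧ ik.1 = jl.1) := fun h' => by
    simp only [stageBlock] at h; omega
  simp [shift, this]

lemma causal_blockDiagonal {r s : ℕ} (M : Fin (T + 1) → Matrix (Fin r) (Fin s) ℝ) :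
    Causal stageBlock stageBlock (Matrix.blockDiagonal M) := by
  intro ik jl h
  rw [Matrix.blockDiagonal_apply, if_neg]
  intro h'
  simp [stageBlock, h'] at h

lemma causal_calE : Causal stageBlock deltaBlock S.calE := by
  rintro ⟨i, k⟩ (j | ⟨j, l⟩) h
  · simp [deltaBlock] at h
  · simp only [stageBlock, deltaBlock, Sum.elim_inr] at h
    have : k ≠ l.succ := fun h' => by simp [h'] at h
    simp [calE, this]

lemma strictlyCausal_shift_calA : StrictlyCausal stageBlock stageBlock (shift * S.calA) :=
  strictlyCausal_shift.mul (causal_blockDiagonal S.A)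

lemma strictlyCausal_shift_calB : StrictlyCausal stageBlock stageBlock
    ((shift : Matrix (StateIdx T n) (StateIdx T n) ℝ) * S.calB) :=
  strictlyCausal_shift.mul (causal_blockDiagonal S.B)

lemma isUnit_det_one_sub : IsUnit (1 - shift * S.calA).det :=
  (Matrix.isUnit_iff_isUnit_det _).1 S.strictlyCausal_shift_calA.isUnit_one_sub

lemma strictlyCausal_opF : StrictlyCausal stageBlock stageBlock S.opF := by
  rw [opF, Matrix.mul_assoc]
  exact S.strictlyCausal_shift_calA.causal_inv_one_sub.mul_strictly S.strictlyCausal_shift_calB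

lemma causal_opG : Causal stageBlock deltaBlock S.opG :=
  S.strictlyCausal_shift_calA.causal_inv_one_sub.mul S.causal_calE

/-- The dynamics in stacked form. -/
lemma one_sub_mulVec_stack_state (x0 : Fin n → ℝ) (u : Fin (T + 1) → Fin m → ℝ)
    (w : Fin T → Fin p → ℝ) :
    (1 - shift * S.calA) *ᵥ stack (S.state x0 u w)
      = ((shift : Matrix (StateIdx T n) (StateIdx T n) ℝ) * S.calB) *ᵥ stack u + S.calE *ᵥ delta x0 w := by
  rw [Matrix.sub_mulVec, Matrix.one_mulVec, sub_eq_iff_eq_add, ← Matrix.mulVec_mulVec,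
    ← Matrix.mulVec_mulVec]
  ext ⟨i, k⟩
  induction k using Fin.cases with
  | zero =>
    simp only [Pi.add_apply, shift_mulVec_zero, calE_mulVec_zero]
    simp [stack, state_zero]
  | succ k =>
    simp only [Pi.add_apply, shift_mulVec_succ, calE_mulVec_succ, calA, calB,
      blockDiagonal_mulVec_apply]
    simp only [stack, state_succ, Pi.add_apply]
    ring

lemma stack_state (x0 : Fin n → ℝ) (u : Fin (T + 1) → Fin m → ℝ) (w : Fin T → Fin p → ℝ) :
    stack (S.state x0 u w) = S.opF *ᵥ stack u + S.opG *ᵥ delta x0 w := by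
  have h := congrArg ((1 - shift * S.calA)⁻¹ *ᵥ ·) (S.one_sub_mulVec_stack_state x0 u w)
  simp only [Matrix.mulVec_mulVec, Matrix.mulVec_add,
    Matrix.nonsing_inv_mul _ S.isUnit_det_one_sub, Matrix.one_mulVec] at h
  rw [h, opF, opG, Matrix.mul_assoc]

/-- The cost, as a quadratic function, of a stacked input `U` when the uncontrolled response is `g`. -/
def quadCost (U : InputIdx T m → ℝ) (g : StateIdx T n → ℝ) : ℝ :=
  (S.opF *ᵥ U + g) ⬝ᵥ S.calQ *ᵥ (S.opF *ᵥ U + g) + U ⬝ᵥ S.calR *ᵥ U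

lemma cost_eq_quadCost (x0 : Fin n → ℝ) (u : Fin (T + 1) → Fin m → ℝ) (w : Fin T → Fin p → ℝ) :
    S.cost x0 u w = S.quadCost (stack u) (S.opG *ᵥ delta x0 w) := by
  rw [quadCost, ← stack_state, calQ, calR, dotProduct_blockDiagonal_mulVec,
    dotProduct_blockDiagonal_mulVec, ← Finset.sum_add_distrib]
  rfl

variable {S} (hQ : ∀ k, (S.Q k).PosSemidef) (hR : ∀ k, (S.R k).PosDef)
include hQ

lemma posSemidef_calQ : S.calQ.PosSemidef := posSemidef_blockDiagonal hQ

lemma transpose_calQ : S.calQᵀ = S.calQ := by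
  simpa using (posSemidef_calQ hQ).1.eq

omit hQ
include hR

lemma posDef_calR : S.calR.PosDef := posDef_blockDiagonal hR

lemma transpose_calR : S.calRᵀ = S.calR := by
  simpa using (posDef_calR hR).1.eq

lemma posSemidef_opF_inv_opF : (S.opF * S.calR⁻¹ * S.opFᵀ).PosSemidef := by
  simpa using (posDef_calR hR).inv.posSemidef.mul_mul_conjTranspose_same S.opF

include hQ

lemma isUnit_det_one_add : IsUnit (1 + S.opF * S.calR⁻¹ * S.opFᵀ * S.calQ).det := by
  rw [← Matrix.isUnit_iff_isUnit_det, ← Matrix.mulVec_injective_iff_isUnit]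
  refine (injective_iff_map_eq_zero (Matrix.mulVecLin _)).2 fun y hy => ?_
  have hy1 : y + (S.opF * S.calR⁻¹ * S.opFᵀ) *ᵥ (S.calQ *ᵥ y) = 0 := by
    have : (1 + S.opF * S.calR⁻¹ * S.opFᵀ * S.calQ) *ᵥ y = 0 := hy
    rwa [Matrix.add_mulVec, Matrix.one_mulVec, ← Matrix.mulVec_mulVec] at this
  have h1 : (S.calQ *ᵥ y) ⬝ᵥ y + (S.calQ *ᵥ y) ⬝ᵥ
      (S.opF * S.calR⁻¹ * S.opFᵀ) *ᵥ (S.calQ *ᵥ y) = 0 := by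
    rw [← dotProduct_add, hy1, dotProduct_zero]
  have h2 : 0 ≤ (S.calQ *ᵥ y) ⬝ᵥ (S.opF * S.calR⁻¹ * S.opFᵀ) *ᵥ (S.calQ *ᵥ y) :=
    (posSemidef_opF_inv_opF hR).dotProduct_mulVec_nonneg _
  have h3 : 0 ≤ y ⬝ᵥ S.calQ *ᵥ y := (posSemidef_calQ hQ).dotProduct_mulVec_nonneg _
  rw [dotProduct_comm] at h1
  have h4 : S.calQ *ᵥ y = 0 :=
    ((posSemidef_calQ hQ).dotProduct_mulVec_zero_iff y).1 (by simp; linarith)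
  rwa [h4, Matrix.mulVec_zero, add_zero] at hy1

/-- The optimal non-causal cost, by completion of squares: the minimiser is
`-ℛ⁻¹ Fᵀ 𝒬 y` with `y = (1 + F ℛ⁻¹ Fᵀ 𝒬)⁻¹ g` the optimal state sequence. -/
lemma isLeast_quadCost (g : StateIdx T n → ℝ) :
    IsLeast (Set.range fun U => S.quadCost U g)
      (g ⬝ᵥ (S.calQ * (1 + S.opF * S.calR⁻¹ * S.opFᵀ * S.calQ)⁻¹) *ᵥ g) := by
  set y := (1 + S.opF * S.calR⁻¹ * S.opFᵀ * S.calQ)⁻¹ *ᵥ g with hy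
  set U₀ := -(S.calR⁻¹ *ᵥ (S.opFᵀ *ᵥ (S.calQ *ᵥ y))) with hU₀
  have hRu := (Matrix.isUnit_iff_isUnit_det _).1 (posDef_calR hR).isUnit
  have hyg : y + S.opF *ᵥ (S.calR⁻¹ *ᵥ (S.opFᵀ *ᵥ (S.calQ *ᵥ y))) = g := by
    have : (1 + S.opF * S.calR⁻¹ * S.opFᵀ * S.calQ) *ᵥ y = g := by
      rw [hy, Matrix.mulVec_mulVec, Matrix.mul_nonsing_inv _ (isUnit_det_one_add hQ hR),
        Matrix.one_mulVec]
    rwa [Matrix.add_mulVec, Matrix.one_mulVec, ← Matrix.mulVec_mulVec, ← Matrix.mulVec_mulVec,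
      ← Matrix.mulVec_mulVec] at this
  have hx : S.opF *ᵥ U₀ + g = y := by
    rw [hU₀, Matrix.mulVec_neg, ← hyg]; abel
  have hstat : S.opFᵀ *ᵥ (S.calQ *ᵥ y) + S.calR *ᵥ U₀ = 0 := by
    rw [hU₀, Matrix.mulVec_neg, Matrix.mulVec_mulVec _ S.calR, Matrix.mul_nonsing_inv _ hRu,
      Matrix.one_mulVec, add_neg_cancel]
  have hexp : ∀ V, S.quadCost (U₀ + V) g = S.quadCost U₀ g
      + ((S.opF *ᵥ V) ⬝ᵥ S.calQ *ᵥ (S.opF *ᵥ V) + V ⬝ᵥ S.calR *ᵥ V) := by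
    intro V
    have e1 : S.opF *ᵥ (U₀ + V) + g = y + S.opF *ᵥ V := by
      rw [Matrix.mulVec_add, ← hx]; abel
    have e3 : (S.opF *ᵥ V) ⬝ᵥ S.calQ *ᵥ y = V ⬝ᵥ S.opFᵀ *ᵥ (S.calQ *ᵥ y) := by
      rw [Matrix.mulVec_transpose, ← dotProduct_comm (S.calQ *ᵥ y), Matrix.dotProduct_mulVec,
        dotProduct_comm]
    have e2 : y ⬝ᵥ S.calQ *ᵥ (S.opF *ᵥ V) = V ⬝ᵥ S.opFᵀ *ᵥ (S.calQ *ᵥ y) := by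
      rw [← e3, Matrix.dotProduct_mulVec, ← Matrix.mulVec_transpose, transpose_calQ hQ,
        dotProduct_comm]
    have e4 : U₀ ⬝ᵥ S.calR *ᵥ V = V ⬝ᵥ S.calR *ᵥ U₀ := by
      rw [Matrix.dotProduct_mulVec, ← Matrix.mulVec_transpose, transpose_calR hR, dotProduct_comm]
    have e5 : V ⬝ᵥ S.opFᵀ *ᵥ (S.calQ *ᵥ y) + V ⬝ᵥ S.calR *ᵥ U₀ = 0 := by
      rw [← dotProduct_add, hstat, dotProduct_zero]
    rw [quadCost, quadCost, e1, hx]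
    simp only [Matrix.mulVec_add, dotProduct_add, add_dotProduct, e2, e3, e4]
    linarith
  have hval : S.quadCost U₀ g
      = g ⬝ᵥ (S.calQ * (1 + S.opF * S.calR⁻¹ * S.opFᵀ * S.calQ)⁻¹) *ᵥ g := by
    rw [← Matrix.mulVec_mulVec, ← hy, quadCost, hx]
    have e1 : S.calR *ᵥ U₀ = -(S.opFᵀ *ᵥ (S.calQ *ᵥ y)) := by
      rw [eq_neg_iff_add_eq_zero, add_comm, hstat]
    have e2 : U₀ ⬝ᵥ S.opFᵀ *ᵥ (S.calQ *ᵥ y) = (S.opF *ᵥ U₀) ⬝ᵥ S.calQ *ᵥ y := by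
      rw [dotProduct_comm, Matrix.mulVec_transpose, ← Matrix.dotProduct_mulVec, dotProduct_comm]
    rw [e1, dotProduct_neg, e2, ← hx]
    simp only [add_dotProduct]
    ring
  refine ⟨⟨U₀, hval⟩, ?_⟩
  rintro _ ⟨U, rfl⟩
  have h1 := hexp (U - U₀)
  have h2 : 0 ≤ (S.opF *ᵥ (U - U₀)) ⬝ᵥ S.calQ *ᵥ (S.opF *ᵥ (U - U₀)) :=
    (posSemidef_calQ hQ).dotProduct_mulVec_nonneg _
  have h3 : 0 ≤ (U - U₀) ⬝ᵥ S.calR *ᵥ (U - U₀) :=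
    (posDef_calR hR).posSemidef.dotProduct_mulVec_nonneg _
  rw [add_sub_cancel] at h1
  simp only
  rw [h1, ← hval]
  linarith

lemma isLeast_quadCost_opG (δ : DeltaIdx T n p → ℝ) :
    IsLeast (Set.range fun U => S.quadCost U (S.opG *ᵥ δ)) (δ ⬝ᵥ S.calO *ᵥ δ) := by
  have : δ ⬝ᵥ S.calO *ᵥ δ = (S.opG *ᵥ δ) ⬝ᵥ
      (S.calQ * (1 + S.opF * S.calR⁻¹ * S.opFᵀ * S.calQ)⁻¹) *ᵥ (S.opG *ᵥ δ) := by
    rw [calO, Matrix.mul_assoc S.opGᵀ, ← Matrix.mulVec_mulVec, ← Matrix.mulVec_mulVec,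
      Matrix.mulVec_transpose, dotProduct_comm, ← Matrix.dotProduct_mulVec, dotProduct_comm]
  rw [this]
  exact isLeast_quadCost hQ hR _

lemma optCost_eq (x0 : Fin n → ℝ) (w : Fin T → Fin p → ℝ) :
    S.optCost x0 w = delta x0 w ⬝ᵥ S.calO *ᵥ delta x0 w := by
  rw [← (isLeast_quadCost_opG hQ hR (delta x0 w)).csInf_eq, optCost, iInf]
  congr 1
  ext c
  constructor
  · rintro ⟨u, rfl⟩
    exact ⟨stack u, (S.cost_eq_quadCost x0 u w).symm⟩
  · rintro ⟨U, rfl⟩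
    exact ⟨fun k i => U (i, k), S.cost_eq_quadCost x0 _ w⟩

/-- `𝒪` is symmetric, by the push-through identity `𝒬 (1 + N 𝒬)⁻¹ = (1 + 𝒬 N)⁻¹ 𝒬`. -/
lemma transpose_calO : S.calOᵀ = S.calO := by
  set N := S.opF * S.calR⁻¹ * S.opFᵀ with hN
  have hNt : Nᵀ = N := (posSemidef_opF_inv_opF hR).1.eq
  have hu : IsUnit (1 + N * S.calQ).det := isUnit_det_one_add hQ hR
  have hu' : IsUnit (1 + S.calQ * N).det := by
    rw [← Matrix.det_transpose] at hu
    simpa [Matrix.transpose_mul, hNt, transpose_calQ hQ] using hu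
  have hpush : S.calQ * (1 + N * S.calQ)⁻¹ = (1 + S.calQ * N)⁻¹ * S.calQ := by
    have h1 : (1 + S.calQ * N) * S.calQ = S.calQ * (1 + N * S.calQ) := by
      simp only [Matrix.add_mul, Matrix.mul_add, Matrix.one_mul, Matrix.mul_one, Matrix.mul_assoc]
    calc S.calQ * (1 + N * S.calQ)⁻¹
        = (1 + S.calQ * N)⁻¹ * ((1 + S.calQ * N) * S.calQ) * (1 + N * S.calQ)⁻¹ := by
          rw [← Matrix.mul_assoc, Matrix.nonsing_inv_mul _ hu', Matrix.one_mul]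
      _ = (1 + S.calQ * N)⁻¹ * S.calQ := by
          rw [h1, Matrix.mul_assoc, Matrix.mul_assoc, Matrix.mul_nonsing_inv _ hu, Matrix.mul_one]
  rw [calO, ← hN, Matrix.mul_assoc S.opGᵀ]
  simp only [Matrix.transpose_mul, Matrix.transpose_transpose, Matrix.transpose_nonsing_inv,
    Matrix.transpose_add, Matrix.transpose_one, hNt, transpose_calQ hQ]
  rw [← hpush]
  simp only [Matrix.mul_assoc]

end LQData

/-! ### The regret form and the linear matrix inequalities -/

/-- Index set of the homogenised disturbance vector `(t, 𝐰)`. -/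
abbrev AugIdx (T p : ℕ) := Unit ⊕ DistIdx T p

variable (T p) in
/-- The matrix `diag (x_0, I)` that maps `(t, 𝐰)` to `δ = (t x_0, 𝐰)`. -/
def lift (x0 : Fin n → ℝ) : Matrix (DeltaIdx T n p) (AugIdx T p) ℝ :=
  Matrix.fromBlocks (Matrix.replicateCol Unit x0) 0 0 1

/-- The homogenised disturbance vector `(1, 𝐰)`. -/
def aug (w : Fin T → Fin p → ℝ) : AugIdx T p → ℝ :=
  Sum.elim (fun _ => 1) (fun jk => w jk.2 jk.1)

lemma lift_mulVec_sumElim (x0 : Fin n → ℝ) (t : ℝ) (y : DistIdx T p → ℝ) :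
    lift T p x0 *ᵥ Sum.elim (fun _ => t) y = Sum.elim (t • x0) y := by
  rw [lift, Matrix.fromBlocks_mulVec]
  ext (i | j)
  · simp [Matrix.mulVec, dotProduct, mul_comm]
  · simp

lemma lift_mulVec_aug (x0 : Fin n → ℝ) (w : Fin T → Fin p → ℝ) :
    lift T p x0 *ᵥ aug w = delta x0 w := by
  rw [aug, lift_mulVec_sumElim, one_smul, delta]

namespace LQData

variable (S : LQData T n m p)

/-- The matrix of the form `J - J^*` on `(t, 𝐰)`, for the input `Ψ (t, 𝐰)`. -/
def regretMatrix (x0 : Fin n → ℝ) (Ψ : Matrix (InputIdx T m) (AugIdx T p) ℝ) :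
    Matrix (AugIdx T p) (AugIdx T p) ℝ :=
  (S.opF * Ψ + S.opG * lift T p x0)ᵀ * S.calQ * (S.opF * Ψ + S.opG * lift T p x0) + Ψᵀ * S.calR * Ψ
    - (lift T p x0)ᵀ * S.calO * lift T p x0

/-- The matrix of the form `μ δᵀ W δ - (J - J^*)` on `(t, 𝐰)`, for the input `Ψ (t, 𝐰)`. -/
def slackMatrix (W : Matrix (DeltaIdx T n p) (DeltaIdx T n p) ℝ) (x0 : Fin n → ℝ) (μ : ℝ)
    (Ψ : Matrix (InputIdx T m) (AugIdx T p) ℝ) : Matrix (AugIdx T p) (AugIdx T p) ℝ :=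
  μ • ((lift T p x0)ᵀ * W * lift T p x0) - S.regretMatrix x0 Ψ

omit S in
variable (T m p) in
/-- The input responses `(t, 𝐰) ↦ Φ_u (t x_0, 𝐰)` of causal matrices `Φ_u`. -/
def responses (x0 : Fin n → ℝ) : Submodule ℝ (Matrix (InputIdx T m) (AugIdx T p) ℝ) where
  carrier := {Ψ | ∃ Φu : Matrix (InputIdx T m) (DeltaIdx T n p) ℝ, IsCausalDelta Φu ∧
    Φu * lift T p x0 = Ψ}
  zero_mem' := ⟨0, fun _ _ _ => rfl, Matrix.zero_mul _⟩
  add_mem' := by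
    rintro _ _ ⟨Φ, h, rfl⟩ ⟨Φ', h', rfl⟩
    exact ⟨Φ + Φ', fun i j hij => by simp [h i j hij, h' i j hij], Matrix.add_mul _ _ _⟩
  smul_mem' := by
    rintro c _ ⟨Φ, h, rfl⟩
    exact ⟨c • Φ, fun i j hij => by simp [h i j hij], Matrix.smul_mul _ _ _⟩

omit S in
lemma dotProduct_conj_mulVec {α β : Type*} [Fintype α] [Fintype β] (M : Matrix α α ℝ)
    (L : Matrix α β ℝ) (z : β → ℝ) :
    z ⬝ᵥ (Lᵀ * M * L) *ᵥ z = (L *ᵥ z) ⬝ᵥ M *ᵥ (L *ᵥ z) := by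
  rw [Matrix.mul_assoc, ← Matrix.mulVec_mulVec, ← Matrix.mulVec_mulVec, Matrix.mulVec_transpose,
    dotProduct_comm, ← Matrix.dotProduct_mulVec, dotProduct_comm]

lemma dotProduct_regretMatrix_mulVec (x0 : Fin n → ℝ) (Ψ : Matrix (InputIdx T m) (AugIdx T p) ℝ)
    (z : AugIdx T p → ℝ) :
    z ⬝ᵥ S.regretMatrix x0 Ψ *ᵥ z = S.quadCost (Ψ *ᵥ z) (S.opG *ᵥ (lift T p x0 *ᵥ z))
      - (lift T p x0 *ᵥ z) ⬝ᵥ S.calO *ᵥ (lift T p x0 *ᵥ z) := by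
  rw [regretMatrix, Matrix.sub_mulVec, Matrix.add_mulVec, dotProduct_sub, dotProduct_add,
    dotProduct_conj_mulVec, dotProduct_conj_mulVec, dotProduct_conj_mulVec, quadCost,
    Matrix.add_mulVec, ← Matrix.mulVec_mulVec, ← Matrix.mulVec_mulVec]

variable {S} (hQ : ∀ k, (S.Q k).PosSemidef) (hR : ∀ k, (S.R k).PosDef)
include hQ hR

lemma posSemidef_regretMatrix (x0 : Fin n → ℝ) (Ψ : Matrix (InputIdx T m) (AugIdx T p) ℝ) :
    (S.regretMatrix x0 Ψ).PosSemidef := by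
  refine .of_dotProduct_mulVec_nonneg ?_ fun z => ?_
  · rw [Matrix.IsHermitian, Matrix.conjTranspose_eq_transpose_of_trivial, regretMatrix]
    simp only [Matrix.transpose_sub, Matrix.transpose_add, Matrix.transpose_mul,
      Matrix.transpose_transpose, transpose_calQ hQ, transpose_calR hR, transpose_calO hQ hR,
      Matrix.mul_assoc]
  · rw [star_trivial, dotProduct_regretMatrix_mulVec, sub_nonneg]
    exact (isLeast_quadCost_opG hQ hR _).2 ⟨_, rfl⟩

omit hQ hR in
lemma exists_response_iff {x0 : Fin n → ℝ}
    {Pr : Matrix (InputIdx T m) (AugIdx T p) ℝ → Prop} :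
    (∃ Ψ ∈ responses T m p x0, Pr Ψ) ↔
      ∃ Φu : Matrix (InputIdx T m) (DeltaIdx T n p) ℝ, IsCausalDelta Φu ∧ Pr (Φu * lift T p x0) :=
  ⟨fun ⟨_, ⟨Φu, h, e⟩, h'⟩ => ⟨Φu, h, e ▸ h'⟩, fun ⟨Φu, h, h'⟩ => ⟨_, ⟨Φu, h, rfl⟩, h'⟩⟩

lemma regretLE_iff {W : Matrix (DeltaIdx T n p) (DeltaIdx T n p) ℝ} {x0 : Fin n → ℝ} {μ : ℝ}
    {Φu : Matrix (InputIdx T m) (DeltaIdx T n p) ℝ} {u : Fin (T + 1) → Fin m → ℝ}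
    {w : Fin T → Fin p → ℝ} (hu : stack u = Φu *ᵥ delta x0 w) :
    S.RegretLE W x0 μ u w ↔ 0 ≤ aug w ⬝ᵥ S.slackMatrix W x0 μ (Φu * lift T p x0) *ᵥ aug w := by
  rw [RegretLE, slackMatrix, Matrix.sub_mulVec, dotProduct_sub, dotProduct_regretMatrix_mulVec,
    Matrix.smul_mulVec, dotProduct_smul, dotProduct_conj_mulVec, ← Matrix.mulVec_mulVec,
    lift_mulVec_aug, ← hu, ← cost_eq_quadCost, optCost_eq hQ hR, sub_nonneg, smul_eq_mul]

lemma mem_pwbLevels_iff {W : Matrix (DeltaIdx T n p) (DeltaIdx T n p) ℝ}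
    {P : Matrix (Fin p) (Fin p) ℝ} {x0 : Fin n → ℝ} {μ : ℝ} :
    μ ∈ S.pwbLevels W P x0 ↔ ∃ Ψ ∈ responses T m p x0, ∀ w, PointwiseBounded P w →
      0 ≤ aug w ⬝ᵥ S.slackMatrix W x0 μ Ψ *ᵥ aug w := by
  rw [exists_response_iff]
  refine exists_congr fun Φu => and_congr_right fun _ => forall_congr' fun w =>
    imp_congr_right fun _ => ?_
  exact regretLE_iff hQ hR rfl

omit hQ hR

/-- The affine constraint of a system response says `Φ_x = F Φ_u + G`, which is causal whenever `Φ_u`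
is. -/
lemma isSystemResponse_iff {Φ : Matrix (StateIdx T n ⊕ InputIdx T m) (DeltaIdx T n p) ℝ} :
    S.IsSystemResponse Φ ↔ IsCausalDelta Φ.toRows₂ ∧ Φ.toRows₁ = S.opF * Φ.toRows₂ + S.opG := by
  have key : Matrix.fromCols (1 - shift * S.calA)
      (-((shift : Matrix (StateIdx T n) (StateIdx T n) ℝ) * S.calB)) * Φ = S.calE ↔
      Φ.toRows₁ = S.opF * Φ.toRows₂ + S.opG := by
    conv_lhs => rw [← Matrix.fromRows_toRows Φ]
    rw [Matrix.fromCols_mul_fromRows, Matrix.neg_mul, ← sub_eq_add_neg, sub_eq_iff_eq_add]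
    constructor
    · intro h
      have := congrArg ((1 - shift * S.calA)⁻¹ * ·) h
      simp only [← Matrix.mul_assoc, Matrix.mul_add,
        Matrix.nonsing_inv_mul _ S.isUnit_det_one_sub, Matrix.one_mul] at this
      rw [this, opF, opG, add_comm]
    · intro h
      rw [h, opF, opG, Matrix.mul_add]
      simp only [← Matrix.mul_assoc, Matrix.mul_nonsing_inv _ S.isUnit_det_one_sub, Matrix.one_mul]
      rw [add_comm]
  constructor
  · rintro ⟨-, h2, h3⟩
    exact ⟨h2, key.1 h3⟩
  · rintro ⟨h2, h3⟩
    refine ⟨?_, h2, key.2 h3⟩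
    rw [h3]
    exact (S.strictlyCausal_opF.causal.mul h2).add S.causal_opG

include hQ hR

/-- Schur complement of the identity block of the linear matrix inequality. -/
lemma posSemidef_lmiMatrix_iff {W : Matrix (DeltaIdx T n p) (DeltaIdx T n p) ℝ} (hW : Wᵀ = W)
    {x0 : Fin n → ℝ} {μ s : ℝ} {Λ : Matrix (DistIdx T p) (DistIdx T p) ℝ}
    {Φ : Matrix (StateIdx T n ⊕ InputIdx T m) (DeltaIdx T n p) ℝ} (hΦ : S.IsSystemResponse Φ) :
    (S.lmiMatrix W x0 μ s Λ Φ).PosSemidef ↔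
      (S.slackMatrix W x0 μ (Φ.toRows₂ * lift T p x0)
        + Matrix.fromBlocks (-(s • (1 : Matrix Unit Unit ℝ))) 0 0 Λ).PosSemidef := by
  have hC : (0 : Matrix (StateIdx T n ⊕ InputIdx T m) (StateIdx T n ⊕ InputIdx T m) ℝ) ≤ S.calC := by
    rw [Matrix.nonneg_iff_posSemidef]
    refine .of_dotProduct_mulVec_nonneg ?_ fun z => ?_
    · exact Matrix.IsHermitian.fromBlocks (posSemidef_calQ hQ).1 (by simp) (posDef_calR hR).1
    · rw [calC, star_trivial, ← Sum.elim_comp_inl_inr z, Matrix.fromBlocks_mulVec]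
      simp only [Sum.elim_comp_inl, Sum.elim_comp_inr, Matrix.zero_mulVec, add_zero, zero_add,
        sumElim_dotProduct_sumElim]
      exact add_nonneg ((posSemidef_calQ hQ).dotProduct_mulVec_nonneg _)
        ((posDef_calR hR).posSemidef.dotProduct_mulVec_nonneg _)
  set Ch := CFC.sqrt S.calC with hCh
  have hChh : Chᵀ = Ch := (Matrix.nonneg_iff_posSemidef.1 (CFC.sqrt_nonneg S.calC)).1
  have hCC : Ch * Ch = S.calC := CFC.sqrt_mul_sqrt_self _ hC
  have hO := transpose_calO hQ hR
  set H : Matrix (AugIdx T p) (AugIdx T p) ℝ := (lift T p x0)ᵀ * (S.calO + μ • W) * lift T p x0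
    + Matrix.fromBlocks (-(s • (1 : Matrix Unit Unit ℝ))) 0 0 Λ with hH
  have hΦL : Φ * lift T p x0
      = Matrix.fromCols (Φ.toCols₁ * Matrix.replicateCol Unit x0) Φ.toCols₂ := by
    conv_lhs => rw [← Matrix.fromCols_toCols Φ]
    rw [lift, Matrix.fromCols_mul_fromBlocks]
    simp
  have hH' : H = Matrix.fromBlocks
      ((Matrix.replicateCol Unit x0)ᵀ * (S.calO.toBlocks₁₁ + μ • W.toBlocks₁₁)
        * Matrix.replicateCol Unit x0 - s • (1 : Matrix Unit Unit ℝ))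
      ((Matrix.replicateCol Unit x0)ᵀ * (S.calO.toBlocks₂₁ᵀ + μ • W.toBlocks₂₁ᵀ))
      ((S.calO.toBlocks₂₁ + μ • W.toBlocks₂₁) * Matrix.replicateCol Unit x0)
      (Λ + S.calO.toBlocks₂₂ + μ • W.toBlocks₂₂) := by
    have eO : S.calO.toBlocks₂₁ᵀ = S.calO.toBlocks₁₂ := by
      conv_rhs => rw [← hO]
      rfl
    have eW : W.toBlocks₂₁ᵀ = W.toBlocks₁₂ := by
      conv_rhs => rw [← hW]
      rfl
    have eB : S.calO + μ • W = Matrix.fromBlocks (S.calO.toBlocks₁₁ + μ • W.toBlocks₁₁)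
        (S.calO.toBlocks₁₂ + μ • W.toBlocks₁₂) (S.calO.toBlocks₂₁ + μ • W.toBlocks₂₁)
        (S.calO.toBlocks₂₂ + μ • W.toBlocks₂₂) := by
      conv_lhs => rw [← Matrix.fromBlocks_toBlocks S.calO, ← Matrix.fromBlocks_toBlocks W]
      rw [Matrix.fromBlocks_smul, Matrix.fromBlocks_add]
    rw [hH, eB, lift, Matrix.fromBlocks_transpose, Matrix.fromBlocks_multiply,
      Matrix.fromBlocks_multiply, Matrix.fromBlocks_add, eO, eW]
    simp [sub_eq_add_neg, add_comm, add_left_comm]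
  have hM : (S.lmiMatrix W x0 μ s Λ Φ).submatrix (Equiv.sumAssoc _ _ _) (Equiv.sumAssoc _ _ _)
      = Matrix.fromBlocks H (Ch * (Φ * lift T p x0))ᴴ ((Ch * (Φ * lift T p x0))ᴴ)ᴴ 1 := by
    rw [hH', hΦL, Matrix.conjTranspose_conjTranspose, Matrix.conjTranspose_eq_transpose_of_trivial,
      Matrix.transpose_mul, hChh, Matrix.transpose_fromCols, Matrix.transpose_mul,
      Matrix.fromRows_mul, Matrix.mul_fromCols]
    ext ((i | i) | i) ((j | j) | j)
    all_goals simp [lmiMatrix, ← hCh, Matrix.mul_assoc]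
  have hCΦ : Φᵀ * S.calC * Φ =
      Φ.toRows₁ᵀ * S.calQ * Φ.toRows₁ + Φ.toRows₂ᵀ * S.calR * Φ.toRows₂ := by
    conv_lhs => rw [← Matrix.fromRows_toRows Φ]
    rw [Matrix.transpose_fromRows, calC, Matrix.fromCols_mul_fromBlocks,
      Matrix.fromCols_mul_fromRows]
    simp
  have : Invertible (1 : Matrix (StateIdx T n ⊕ InputIdx T m) (StateIdx T n ⊕ InputIdx T m) ℝ) :=
    invertibleOne
  rw [← Matrix.posSemidef_submatrix_equiv (Equiv.sumAssoc _ _ _), hM,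
    Matrix.PosDef.fromBlocks₂₂ _ _ Matrix.PosDef.one]
  have : H - (Ch * (Φ * lift T p x0))ᴴ
        * (1 : Matrix (StateIdx T n ⊕ InputIdx T m) (StateIdx T n ⊕ InputIdx T m) ℝ)⁻¹
        * (((Ch * (Φ * lift T p x0))ᴴ)ᴴ : Matrix (StateIdx T n ⊕ InputIdx T m) (AugIdx T p) ℝ)
      = S.slackMatrix W x0 μ (Φ.toRows₂ * lift T p x0)
        + Matrix.fromBlocks (-(s • (1 : Matrix Unit Unit ℝ))) 0 0 Λ := by
    have e1 : (Ch * (Φ * lift T p x0))ᴴ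
        * (1 : Matrix (StateIdx T n ⊕ InputIdx T m) (StateIdx T n ⊕ InputIdx T m) ℝ)⁻¹
        * (((Ch * (Φ * lift T p x0))ᴴ)ᴴ : Matrix (StateIdx T n ⊕ InputIdx T m) (AugIdx T p) ℝ)
        = (lift T p x0)ᵀ * (Φᵀ * S.calC * Φ) * lift T p x0 := by
      rw [inv_one, Matrix.mul_one, Matrix.conjTranspose_conjTranspose,
        Matrix.conjTranspose_eq_transpose_of_trivial, Matrix.transpose_mul, hChh,
        Matrix.transpose_mul, ← hCC]
      simp only [Matrix.mul_assoc]
    rw [e1, hCΦ, (isSystemResponse_iff.1 hΦ).2, hH, slackMatrix, regretMatrix]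
    simp only [Matrix.transpose_add, Matrix.transpose_mul, Matrix.mul_add, Matrix.add_mul,
      Matrix.mul_assoc, Matrix.mul_smul, Matrix.smul_mul]
    abel
  rw [this]

lemma exists_posSemidef_lmiMatrix_iff {W : Matrix (DeltaIdx T n p) (DeltaIdx T n p) ℝ} (hW : Wᵀ = W)
    {x0 : Fin n → ℝ} {μ s : ℝ} {Λ : Matrix (DistIdx T p) (DistIdx T p) ℝ} :
    (∃ Φ, S.IsSystemResponse Φ ∧ (S.lmiMatrix W x0 μ s Λ Φ).PosSemidef) ↔
      ∃ Ψ ∈ responses T m p x0, (S.slackMatrix W x0 μ Ψ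
        + Matrix.fromBlocks (-(s • (1 : Matrix Unit Unit ℝ))) 0 0 Λ).PosSemidef := by
  rw [exists_response_iff]
  constructor
  · rintro ⟨Φ, hΦ, h⟩
    exact ⟨Φ.toRows₂, hΦ.2.1, (posSemidef_lmiMatrix_iff hQ hR hW hΦ).1 h⟩
  · rintro ⟨Φu, hΦu, h⟩
    have hΦ : S.IsSystemResponse (Matrix.fromRows (S.opF * Φu + S.opG) Φu) :=
      isSystemResponse_iff.2 ⟨by simpa using hΦu, by simp⟩
    exact ⟨_, hΦ, (posSemidef_lmiMatrix_iff hQ hR hW hΦ).2 (by simpa using h)⟩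

lemma mem_pointwiseSDP_iff {W : Matrix (DeltaIdx T n p) (DeltaIdx T n p) ℝ} (hW : Wᵀ = W)
    {P : Matrix (Fin p) (Fin p) ℝ} {x0 : Fin n → ℝ} {μ : ℝ} :
    μ ∈ S.pointwiseSDP W P x0 ↔ ∃ lam : Fin T → ℝ, (∀ i, 0 ≤ lam i) ∧ ∃ Ψ ∈ responses T m p x0,
      (S.slackMatrix W x0 μ Ψ + Matrix.fromBlocks (-((∑ i, lam i) • (1 : Matrix Unit Unit ℝ))) 0 0
        (∑ i, lam i • calP P i)).PosSemidef := by
  refine exists_congr fun lam => ?_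
  rw [← exists_posSemidef_lmiMatrix_iff hQ hR hW, exists_and_left]

lemma mem_energySDP_iff {W : Matrix (DeltaIdx T n p) (DeltaIdx T n p) ℝ} (hW : Wᵀ = W)
    {ω : ℝ} {x0 : Fin n → ℝ} {μ : ℝ} :
    μ ∈ S.energySDP W ω x0 ↔ ∃ lam : ℝ, 0 ≤ lam ∧ ∃ Ψ ∈ responses T m p x0,
      (S.slackMatrix W x0 μ Ψ + Matrix.fromBlocks (-((lam * ω) • (1 : Matrix Unit Unit ℝ))) 0 0
        (lam • (1 : Matrix (DistIdx T p) (DistIdx T p) ℝ))).PosSemidef := by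
  refine exists_congr fun lam => ?_
  rw [← exists_posSemidef_lmiMatrix_iff hQ hR hW, exists_and_left]

end LQData

/-! ### State feedback -/

lemma isUnit_of_rank_eq {M : Matrix (Fin n) (Fin n) ℝ} (h : M.rank = n) : IsUnit M := by
  rw [← Matrix.mulVec_surjective_iff_isUnit]
  have : LinearMap.range M.mulVecLin = ⊤ :=
    Submodule.eq_top_of_finrank_eq (by rw [← Matrix.rank, h]; simp)
  exact LinearMap.range_eq_top.1 this

namespace LQData

section Feedback

variable (S : LQData T n m n)

/-- The inverse of `ℰ`, for square invertible `E_k`. -/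
def calEInv : Matrix (DeltaIdx T n n) (StateIdx T n) ℝ :=
  Matrix.fromRows
    (Matrix.of fun j ik => if ik.2 = 0 ∧ ik.1 = j then 1 else 0)
    (Matrix.of fun jl ik => if ik.2 = jl.2.succ then (S.E jl.2)⁻¹ jl.1 ik.1 else 0)

lemma causal_calEInv : Causal deltaBlock stageBlock S.calEInv := by
  rintro (j | ⟨j, l⟩) ⟨i, k⟩ h
  · have : k ≠ 0 := fun h' => by simp [deltaBlock, stageBlock, h'] at h
    simp [calEInv, this]
  · have : k ≠ l.succ := fun h' => by simp [deltaBlock, stageBlock, h'] at h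
    simp [calEInv, this]

lemma calEInv_mulVec_calE_mulVec (hE : ∀ k, IsUnit (S.E k)) (x0 : Fin n → ℝ)
    (w : Fin T → Fin n → ℝ) : S.calEInv *ᵥ (S.calE *ᵥ delta x0 w) = delta x0 w := by
  have h1 : ∀ (v : StateIdx T n → ℝ) j, (S.calEInv *ᵥ v) (.inl j) = v (j, 0) := fun v j => by
    rw [Matrix.mulVec, dotProduct, Finset.sum_eq_single (j, 0)]
    · simp [calEInv]
    · rintro ⟨i, k⟩ - hne
      have : ¬ (k = 0 ∧ i = j) := fun h => hne (Prod.ext h.2 h.1)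
      simp [calEInv, this]
    · simp
  have h2 : ∀ (v : StateIdx T n → ℝ) j l, (S.calEInv *ᵥ v) (.inr (j, l))
      = ((S.E l)⁻¹ *ᵥ fun i => v (i, l.succ)) j := fun v j l => by
    simp [calEInv, Matrix.mulVec, dotProduct, Fintype.sum_prod_type]
  ext (j | ⟨j, l⟩)
  · rw [h1, calE_mulVec_zero]; rfl
  · rw [h2]
    have : (fun i => (S.calE *ᵥ delta x0 w) (i, l.succ)) = S.E l *ᵥ w l :=
      funext fun i => S.calE_mulVec_succ x0 w i l
    rw [this, Matrix.mulVec_mulVec,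
      Matrix.nonsing_inv_mul _ ((Matrix.isUnit_iff_isUnit_det _).1 (hE l)), Matrix.one_mulVec]
    rfl

/-- The closed loop of the causal state feedback `𝒦` is the causal response
`(1 - 𝒦 F)⁻¹ 𝒦 G` to `δ`. -/
lemma exists_causalDelta_of_feedback {p : ℕ} (S : LQData T n m p)
    {K : Matrix (InputIdx T m) (StateIdx T n) ℝ} (hK : IsCausalState K) :
    ∃ Φu : Matrix (InputIdx T m) (DeltaIdx T n p) ℝ, IsCausalDelta Φu ∧ ∀ x0 w u,
      stack u = K *ᵥ stack (S.state x0 u w) ↔ stack u = Φu *ᵥ delta x0 w := by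
  have hKF : StrictlyCausal stageBlock stageBlock (K * S.opF) :=
    Causal.mul_strictly hK S.strictlyCausal_opF
  have hu := (Matrix.isUnit_iff_isUnit_det _).1 hKF.isUnit_one_sub
  refine ⟨(1 - K * S.opF)⁻¹ * (K * S.opG),
    hKF.causal_inv_one_sub.mul (Causal.mul hK S.causal_opG), fun x0 w u => ?_⟩
  have h1 : stack u = K *ᵥ stack (S.state x0 u w) ↔
      (1 - K * S.opF) *ᵥ stack u = (K * S.opG) *ᵥ delta x0 w := by
    rw [stack_state, Matrix.mulVec_add, Matrix.mulVec_mulVec, Matrix.mulVec_mulVec,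
      Matrix.sub_mulVec, Matrix.one_mulVec, sub_eq_iff_eq_add']
  rw [h1, ← Matrix.mulVec_mulVec _ (1 - K * S.opF)⁻¹]
  constructor
  · intro h
    rw [← h, Matrix.mulVec_mulVec, Matrix.nonsing_inv_mul _ hu, Matrix.one_mulVec]
  · intro h
    rw [h, Matrix.mulVec_mulVec, Matrix.mul_nonsing_inv _ hu, Matrix.one_mulVec]

/-- If the `E_k` are invertible, then `δ = ℰ⁻¹ ((1 - 𝒵𝒜) 𝐱 - 𝒵ℬ 𝐮)` can be read off causally, and
`Φ_u` is implemented by the feedback `(1 + Φ_u ℰ⁻¹ 𝒵ℬ)⁻¹ Φ_u ℰ⁻¹ (1 - 𝒵𝒜)`. -/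
lemma exists_feedback_of_causalDelta (hE : ∀ k, IsUnit (S.E k))
    {Φu : Matrix (InputIdx T m) (DeltaIdx T n n) ℝ} (hΦ : IsCausalDelta Φu) :
    ∃ K : Matrix (InputIdx T m) (StateIdx T n) ℝ, IsCausalState K ∧ ∀ x0 w u,
      stack u = Φu *ᵥ delta x0 w → stack u = K *ᵥ stack (S.state x0 u w) := by
  set Y : Matrix (InputIdx T m) (StateIdx T n) ℝ := Φu * S.calEInv with hY
  have hYc : Causal stageBlock stageBlock Y := Causal.mul hΦ S.causal_calEInv
  set ZB : Matrix (StateIdx T n) (InputIdx T m) ℝ :=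
    (shift : Matrix (StateIdx T n) (StateIdx T n) ℝ) * S.calB with hZB
  have hN : StrictlyCausal stageBlock stageBlock (-(Y * ZB)) :=
    (hYc.mul_strictly S.strictlyCausal_shift_calB).neg
  have hu := (Matrix.isUnit_iff_isUnit_det _).1 hN.isUnit_one_sub
  refine ⟨(1 - -(Y * ZB))⁻¹ * (Y * (1 - shift * S.calA)), hN.causal_inv_one_sub.mul
    (hYc.mul (Causal.one.sub S.strictlyCausal_shift_calA.causal)), fun x0 w u hux => ?_⟩
  have h1 : Y *ᵥ (S.calE *ᵥ delta x0 w) = stack u := by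
    rw [hY, ← Matrix.mulVec_mulVec, S.calEInv_mulVec_calE_mulVec hE, hux]
  rw [← Matrix.mulVec_mulVec, ← Matrix.mulVec_mulVec, one_sub_mulVec_stack_state,
    Matrix.mulVec_add, h1, ← hZB]
  have h2 : Y *ᵥ (ZB *ᵥ stack u) + stack u = (1 - -(Y * ZB)) *ᵥ stack u := by
    rw [sub_neg_eq_add, Matrix.add_mulVec, Matrix.one_mulVec, Matrix.mulVec_mulVec, add_comm]
  rw [h2, Matrix.mulVec_mulVec, Matrix.nonsing_inv_mul _ hu, Matrix.one_mulVec]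

theorem pwbFeedbackLevels_eq (hE : ∀ k, IsUnit (S.E k))
    (W : Matrix (DeltaIdx T n n) (DeltaIdx T n n) ℝ) (P : Matrix (Fin n) (Fin n) ℝ)
    (x0 : Fin n → ℝ) : S.pwbFeedbackLevels W P x0 = S.pwbLevels W P x0 := by
  have hstack : ∀ (u : Fin (T + 1) → Fin m → ℝ) (v : InputIdx T m → ℝ),
      stack u = v ↔ u = fun k i => v (i, k) := fun u v =>
    ⟨fun h => by rw [← h]; rfl, fun h => by rw [h]; rfl⟩
  have hfb : ∀ (K : Matrix (InputIdx T m) (StateIdx T n) ℝ) (u : Fin (T + 1) → Fin m → ℝ)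
      (x : Fin (T + 1) → Fin n → ℝ),
      (∀ i k, u k i = (K *ᵥ fun jl : StateIdx T n => x jl.2 jl.1) (i, k)) ↔
        stack u = K *ᵥ stack x := fun K u x =>
    ⟨fun h => funext fun ik => h ik.1 ik.2, fun h i k => congrFun h (i, k)⟩
  ext μ
  simp only [pwbFeedbackLevels, pwbLevels, Set.mem_ofPred_eq, hfb]
  constructor
  · rintro ⟨K, hK, h⟩
    obtain ⟨Φu, hΦ, hiff⟩ := S.exists_causalDelta_of_feedback hK
    refine ⟨Φu, hΦ, fun w hw => ?_⟩
    obtain ⟨u, hu, hreg⟩ := h w hw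
    rwa [(hstack u _).1 ((hiff x0 w u).1 hu)] at hreg
  · rintro ⟨Φu, hΦ, h⟩
    obtain ⟨K, hK, himp⟩ := S.exists_feedback_of_causalDelta hE hΦ
    exact ⟨K, hK, fun w hw => ⟨_, himp x0 w _ rfl, h w hw⟩⟩

end Feedback

end LQData

/-! ### Attainment of the minima -/

section Attainment

/-- The projection to `ℝ` of a closed set has a least element if its sublevel sets lie in compact
sets and in the half-space `0 ≤ μ`. -/
lemma exists_isLeast_of_isClosed {Y : Type*} [TopologicalSpace Y] {K : Set (ℝ × Y)}
    (hK : IsClosed K) {s : Set ℝ} (hs : ∀ μ, μ ∈ s ↔ ∃ y, (μ, y) ∈ K) (hne : s.Nonempty)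
    (hB : ∀ μ₁, ∃ B : Set Y, IsCompact B ∧ ∀ μ y, (μ, y) ∈ K → μ ≤ μ₁ → 0 ≤ μ ∧ y ∈ B) :
    ∃ μ, IsLeast s μ := by
  obtain ⟨μ₁, hμ₁⟩ := hne
  obtain ⟨y₁, hy₁⟩ := (hs μ₁).1 hμ₁
  obtain ⟨B, hBc, hB⟩ := hB μ₁
  have hC : IsCompact (K ∩ Set.Icc 0 μ₁ ×ˢ B) := (isCompact_Icc.prod hBc).inter_left hK
  have h1 := hB μ₁ y₁ hy₁ le_rfl
  obtain ⟨⟨μ, y⟩, hmem, hmin⟩ := hC.exists_isMinOn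
    ⟨(μ₁, y₁), hy₁, ⟨h1.1, le_rfl⟩, h1.2⟩ continuous_fst.continuousOn
  refine ⟨μ, (hs μ).2 ⟨y, hmem.1⟩, fun μ' hμ' => ?_⟩
  rcases le_total μ' μ₁ with hle | hle
  · obtain ⟨y', hy'⟩ := (hs μ').1 hμ'
    have h2 := hB μ' y' hy' hle
    exact hmin (a := (μ', y')) ⟨hy', ⟨h2.1, hle⟩, h2.2⟩
  · exact hmem.2.1.2.trans hle

variable {ι κ : Type*}

lemma isCompact_setOf_abs_le (C : κ → ℝ) :
    IsCompact {M : Matrix ι κ ℝ | ∀ i j, |M i j| ≤ C j} := by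
  have h : IsCompact (Set.pi Set.univ fun _ : ι => Set.pi Set.univ fun j : κ => Set.Icc (-C j) (C j)) :=
    isCompact_univ_pi fun _ => isCompact_univ_pi fun _ => isCompact_Icc
  refine (congrArg IsCompact (Set.ext fun M => ?_)).mpr h
  exact ⟨fun hM i _ j _ => abs_le.1 (hM i j),
    fun hM i j => abs_le.2 (hM i (Set.mem_univ _) j (Set.mem_univ _))⟩

variable [Fintype ι]

lemma isClosed_setOf_posSemidef : IsClosed {M : Matrix ι ι ℝ | M.PosSemidef} := by
  simp only [Matrix.posSemidef_iff_dotProduct_mulVec, Set.ofPred_and, Set.ofPred_forall]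
  refine IsClosed.inter ?_ (isClosed_iInter fun z => ?_)
  · exact isClosed_eq continuous_id.matrix_conjTranspose continuous_id
  · exact isClosed_le continuous_const
      (continuous_const.dotProduct (continuous_id.matrix_mulVec continuous_const))

/-- A positive definite matrix dominates every symmetric matrix after scaling. -/
lemma exists_smul_sub_posSemidef [DecidableEq ι] [Nonempty ι] {W M : Matrix ι ι ℝ} (hW : W.PosDef)
    (hM : M.IsHermitian) : ∃ μ : ℝ, (μ • W - M).PosSemidef := by
  obtain ⟨c, hc⟩ : ∃ c, ∀ a b, |M a b| ≤ c := by
    refine ⟨∑ a, ∑ b, |M a b|, fun a b => ?_⟩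
    exact (Finset.single_le_sum (f := fun b => |M a b|) (fun _ _ => abs_nonneg _)
      (Finset.mem_univ b)).trans (Finset.single_le_sum (f := fun a => ∑ b, |M a b|)
        (fun _ _ => Finset.sum_nonneg fun _ _ => abs_nonneg _) (Finset.mem_univ a))
  have hc0 : 0 ≤ c := (abs_nonneg _).trans (hc (Classical.arbitrary ι) (Classical.arbitrary ι))
  have hσ := sigmaMin_pos hW
  refine ⟨c * Fintype.card ι / sigmaMin W, .of_dotProduct_mulVec_nonneg ?_ fun z => ?_⟩
  · exact (hW.1.smul (IsSelfAdjoint.all _)).sub hM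
  · have h1 := (le_abs_self _).trans (abs_dotProduct_mulVec_le hc z)
    have h2 := (posSemidef_sub_sigmaMin hW.posSemidef).dotProduct_mulVec_nonneg z
    simp only [star_trivial, Matrix.sub_mulVec, dotProduct_sub, Matrix.smul_mulVec,
      dotProduct_smul, Matrix.one_mulVec, smul_eq_mul, sub_nonneg] at h2 ⊢
    refine h1.trans ?_
    rw [div_mul_eq_mul_div, le_div_iff₀ hσ, mul_assoc (c * _), mul_comm (z ⬝ᵥ z)]
    exact mul_le_mul_of_nonneg_left h2 (by positivity)

lemma posSemidef_fromBlocks_zero {D : Matrix κ κ ℝ} [Fintype κ] (hD : D.PosSemidef) :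
    (Matrix.fromBlocks (0 : Matrix ι ι ℝ) 0 0 D).PosSemidef := by
  refine .of_dotProduct_mulVec_nonneg ?_ fun z => ?_
  · exact Matrix.IsHermitian.fromBlocks Matrix.isHermitian_zero (by simp) hD.1
  · rw [star_trivial, ← Sum.elim_comp_inl_inr z, Matrix.fromBlocks_mulVec]
    simp only [Sum.elim_comp_inl, Sum.elim_comp_inr, Matrix.zero_mulVec, add_zero, zero_add,
      sumElim_dotProduct_sumElim, dotProduct_zero]
    exact hD.dotProduct_mulVec_nonneg _

end Attainment

lemma exists_pos_pointwiseBounded_smul {P : Matrix (Fin p) (Fin p) ℝ} (hP : P.PosSemidef)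
    (w : Fin T → Fin p → ℝ) : ∃ ε : ℝ, 0 < ε ∧ PointwiseBounded P (ε • w) := by
  have h0 : ∀ k, 0 ≤ w k ⬝ᵥ P *ᵥ w k := fun k => hP.dotProduct_mulVec_nonneg _
  set c := ∑ k, w k ⬝ᵥ P *ᵥ w k with hc
  have hc0 : 0 ≤ c := Finset.sum_nonneg fun k _ => h0 k
  refine ⟨1 / (1 + c), by positivity, fun k => ?_⟩
  have hk : w k ⬝ᵥ P *ᵥ w k ≤ c :=
    Finset.single_le_sum (f := fun k => w k ⬝ᵥ P *ᵥ w k) (fun k _ => h0 k) (Finset.mem_univ k)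
  rw [Pi.smul_apply, Matrix.mulVec_smul, smul_dotProduct, dotProduct_smul, smul_eq_mul, smul_eq_mul,
    ← mul_assoc, div_mul_div_comm, div_mul_eq_mul_div, div_le_one (by positivity)]
  nlinarith

lemma dotProduct_multiplier_mulVec (s : ℝ) (Λ : Matrix (DistIdx T p) (DistIdx T p) ℝ) (t : ℝ)
    (y : DistIdx T p → ℝ) :
    Sum.elim (fun _ => t) y ⬝ᵥ Matrix.fromBlocks (-(s • (1 : Matrix Unit Unit ℝ))) 0 0 Λ
        *ᵥ Sum.elim (fun _ => t) y = -s * t ^ 2 + y ⬝ᵥ Λ *ᵥ y := by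
  rw [Matrix.fromBlocks_mulVec]
  simp only [Sum.elim_comp_inl, Sum.elim_comp_inr, Matrix.zero_mulVec, add_zero, zero_add,
    sumElim_dotProduct_sumElim]
  congr 1
  simp [dotProduct, Matrix.mulVec]
  ring

lemma aug_dotProduct_multiplier_mulVec_aug (s : ℝ) (Λ : Matrix (DistIdx T p) (DistIdx T p) ℝ)
    (w : Fin T → Fin p → ℝ) :
    aug w ⬝ᵥ Matrix.fromBlocks (-(s • (1 : Matrix Unit Unit ℝ))) 0 0 Λ *ᵥ aug w
      = -s + (fun jk : DistIdx T p => w jk.2 jk.1) ⬝ᵥ Λ *ᵥ fun jk => w jk.2 jk.1 := by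
  rw [aug, dotProduct_multiplier_mulVec, one_pow, mul_one]

lemma dotProduct_sum_smul_calP_mulVec (P : Matrix (Fin p) (Fin p) ℝ) (lam : Fin T → ℝ)
    (y : DistIdx T p → ℝ) :
    y ⬝ᵥ (∑ i, lam i • LQData.calP P i) *ᵥ y
      = ∑ i, lam i * ((fun j => y (j, i)) ⬝ᵥ P *ᵥ fun j => y (j, i)) := by
  rw [Matrix.sum_mulVec, dotProduct_sum]
  refine Finset.sum_congr rfl fun i _ => ?_
  rw [Matrix.smul_mulVec, dotProduct_smul, smul_eq_mul, LQData.calP,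
    dotProduct_blockDiagonal_mulVec, Finset.sum_eq_single i]
  · simp
  · intro k _ hk
    simp [hk]
  · simp

lemma isHermitian_sum_smul_calP {P : Matrix (Fin p) (Fin p) ℝ} (hP : P.IsHermitian)
    (lam : Fin T → ℝ) : (∑ i, lam i • LQData.calP P i).IsHermitian := by
  have : ∀ i : Fin T, (LQData.calP P i).IsHermitian := fun i => by
    rw [LQData.calP, Matrix.isHermitian_blockDiagonal_iff]
    intro k
    by_cases hk : k = i
    · subst hk; simpa using hP
    · simp [hk]
  simp only [Matrix.IsHermitian, Matrix.conjTranspose_sum, Matrix.conjTranspose_smul, (this _).eq,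
    star_trivial]

namespace LQData

variable {S : LQData T n m p}

lemma continuous_slackMatrix (W : Matrix (DeltaIdx T n p) (DeltaIdx T n p) ℝ) (x0 : Fin n → ℝ) :
    Continuous fun q : ℝ × Matrix (InputIdx T m) (AugIdx T p) ℝ => S.slackMatrix W x0 q.1 q.2 := by
  unfold slackMatrix regretMatrix
  have h : Continuous fun q : ℝ × Matrix (InputIdx T m) (AugIdx T p) ℝ =>
      S.opF * q.2 + S.opG * lift T p x0 :=
    (continuous_const.matrix_mul continuous_snd).add continuous_const
  exact (continuous_fst.smul continuous_const).sub
    ((((h.matrix_transpose.matrix_mul continuous_const).matrix_mul h).add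
      ((continuous_snd.matrix_transpose.matrix_mul continuous_const).matrix_mul continuous_snd)).sub
      continuous_const)

lemma isClosed_responses (x0 : Fin n → ℝ) :
    IsClosed (responses T m p x0 : Set (Matrix (InputIdx T m) (AugIdx T p) ℝ)) :=
  Submodule.closed_of_finiteDimensional _

variable {W : Matrix (DeltaIdx T n p) (DeltaIdx T n p) ℝ} {P : Matrix (Fin p) (Fin p) ℝ}
  {x0 : Fin n → ℝ}

/-- The multiplier is nonpositive on pointwise bounded disturbances, so the slack is nonnegative
there. -/
lemma slack_nonneg_of_multiplier {lam : Fin T → ℝ} (hlam : ∀ i, 0 ≤ lam i) {μ : ℝ}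
    {Ψ : Matrix (InputIdx T m) (AugIdx T p) ℝ}
    (h : (S.slackMatrix W x0 μ Ψ + Matrix.fromBlocks (-((∑ i, lam i) • (1 : Matrix Unit Unit ℝ))) 0 0
        (∑ i, lam i • calP P i)).PosSemidef) {w : Fin T → Fin p → ℝ} (hw : PointwiseBounded P w) :
    0 ≤ aug w ⬝ᵥ S.slackMatrix W x0 μ Ψ *ᵥ aug w := by
  have h1 := h.dotProduct_mulVec_nonneg (aug w)
  rw [star_trivial, Matrix.add_mulVec, dotProduct_add, aug_dotProduct_multiplier_mulVec_aug,
    dotProduct_sum_smul_calP_mulVec] at h1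
  have h2 : ∑ i, lam i * (w i ⬝ᵥ P *ᵥ w i) ≤ ∑ i, lam i :=
    Finset.sum_le_sum fun i _ => mul_le_of_le_one_right (hlam i) (hw i)
  linarith

/-- An energy multiplier `lam` yields the pointwise multipliers `lam / σ_min(P)`, with the same
offset. -/
lemma pointwise_of_energy [Nonempty (Fin p)] (hP : P.PosDef) {lam : ℝ} (hlam : 0 ≤ lam)
    {M : Matrix (AugIdx T p) (AugIdx T p) ℝ}
    (h : (M + Matrix.fromBlocks (-((lam * (T / sigmaMin P)) • (1 : Matrix Unit Unit ℝ))) 0 0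
        (lam • (1 : Matrix (DistIdx T p) (DistIdx T p) ℝ))).PosSemidef) :
    (M + Matrix.fromBlocks (-((∑ _i : Fin T, lam / sigmaMin P) • (1 : Matrix Unit Unit ℝ))) 0 0
        (∑ i : Fin T, (lam / sigmaMin P) • calP P i)).PosSemidef := by
  have hσ := sigmaMin_pos hP
  have hD : (∑ i : Fin T, (lam / sigmaMin P) • calP P i
      - lam • (1 : Matrix (DistIdx T p) (DistIdx T p) ℝ)).PosSemidef := by
    refine .of_dotProduct_mulVec_nonneg ?_ fun y => ?_
    · exact (isHermitian_sum_smul_calP hP.1 fun _ => _).sub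
        (Matrix.isHermitian_one.smul (IsSelfAdjoint.all _))
    · rw [star_trivial, Matrix.sub_mulVec, dotProduct_sub,
        dotProduct_sum_smul_calP_mulVec P fun _ => lam / sigmaMin P, Matrix.smul_mulVec,
        dotProduct_smul, Matrix.one_mulVec, smul_eq_mul, sub_nonneg, dotProduct,
        Fintype.sum_prod_type_right, Finset.mul_sum]
      refine Finset.sum_le_sum fun i _ => ?_
      have h1 := (posSemidef_sub_sigmaMin hP.posSemidef).dotProduct_mulVec_nonneg fun j => y (j, i)
      simp only [star_trivial, Matrix.sub_mulVec, dotProduct_sub, Matrix.smul_mulVec,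
        dotProduct_smul, Matrix.one_mulVec, smul_eq_mul, sub_nonneg] at h1
      rw [div_mul_eq_mul_div, le_div_iff₀ hσ, mul_assoc, mul_comm _ (sigmaMin P)]
      exact mul_le_mul_of_nonneg_left h1 hlam
  have h2 := h.add (posSemidef_fromBlocks_zero (ι := Unit) hD)
  rw [add_assoc, Matrix.fromBlocks_add] at h2
  have e : lam * (T / sigmaMin P) = ∑ _i : Fin T, lam / sigmaMin P := by
    simp; ring
  simpa [e] using h2

variable (hQ : ∀ k, (S.Q k).PosSemidef) (hR : ∀ k, (S.R k).PosDef)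
include hQ hR

lemma slack_dotProduct_le (μ : ℝ) (Ψ : Matrix (InputIdx T m) (AugIdx T p) ℝ) (z : AugIdx T p → ℝ) :
    z ⬝ᵥ S.slackMatrix W x0 μ Ψ *ᵥ z ≤ μ * ((lift T p x0 *ᵥ z) ⬝ᵥ W *ᵥ (lift T p x0 *ᵥ z)) := by
  rw [slackMatrix, Matrix.sub_mulVec, dotProduct_sub, Matrix.smul_mulVec, dotProduct_smul,
    dotProduct_conj_mulVec, smul_eq_mul]
  have := (posSemidef_regretMatrix hQ hR x0 Ψ).dotProduct_mulVec_nonneg z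
  rw [star_trivial] at this
  linarith

/-- Some admissible `δ` is nonzero and the regret is nonnegative, so levels are nonnegative. -/
lemma level_nonneg (hT : 0 < T) [Nonempty (Fin p)] (hW : W.PosDef) (hP : P.PosDef) {μ : ℝ}
    {Ψ : Matrix (InputIdx T m) (AugIdx T p) ℝ}
    (h : ∀ w, PointwiseBounded P w → 0 ≤ aug w ⬝ᵥ S.slackMatrix W x0 μ Ψ *ᵥ aug w) : 0 ≤ μ := by
  obtain ⟨ε, hε, hw⟩ := exists_pos_pointwiseBounded_smul hP.posSemidef
    (fun (_ : Fin T) (_ : Fin p) => (1 : ℝ))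
  have h1 := (h _ hw).trans (slack_dotProduct_le hQ hR μ Ψ _)
  rw [lift_mulVec_aug] at h1
  refine nonneg_of_mul_nonneg_left h1 (hW.dotProduct_mulVec_pos fun h0 => ?_)
  have := congrFun h0 (.inr (Classical.arbitrary (Fin p), ⟨0, hT⟩))
  simp [hε.ne'] at this

/-- Bounded levels have bounded responses: the cost `ℛ ≻ 0` bounds `Ψ (1, 0)` and `Ψ (1, ε e_j)` for a
small `ε`, and the columns of `Ψ` are combinations of these. -/
lemma exists_bound_response (hW : W.PosDef) (hP : P.PosDef) (μ₁ : ℝ) :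
    ∃ C : AugIdx T p → ℝ, ∀ (μ : ℝ) (Ψ : Matrix (InputIdx T m) (AugIdx T p) ℝ), μ ≤ μ₁ →
      (∀ w, PointwiseBounded P w → 0 ≤ aug w ⬝ᵥ S.slackMatrix W x0 μ Ψ *ᵥ aug w) →
      ∀ i j, |Ψ i j| ≤ C j := by
  set r := sigmaMin S.calR with hr
  set b : (Fin T → Fin p → ℝ) → ℝ := fun w =>
    √((μ₁ * (delta x0 w ⬝ᵥ W *ᵥ delta x0 w) + delta x0 w ⬝ᵥ S.calO *ᵥ delta x0 w) / r) with hb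
  have hbound : ∀ w, PointwiseBounded P w → ∀ (μ : ℝ) (Ψ : Matrix (InputIdx T m) (AugIdx T p) ℝ),
      μ ≤ μ₁ → 0 ≤ aug w ⬝ᵥ S.slackMatrix W x0 μ Ψ *ᵥ aug w →
      ∀ i, |(Ψ *ᵥ aug w) i| ≤ b w := by
    intro w _ μ Ψ hμ h i
    have : Nonempty (InputIdx T m) := ⟨i⟩
    have hr0 : 0 < r := sigmaMin_pos (posDef_calR hR)
    rw [slackMatrix, Matrix.sub_mulVec, dotProduct_sub, dotProduct_regretMatrix_mulVec,
      Matrix.smul_mulVec, dotProduct_smul, dotProduct_conj_mulVec, lift_mulVec_aug,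
      smul_eq_mul] at h
    set v := Ψ *ᵥ aug w
    have h1 : v ⬝ᵥ S.calR *ᵥ v ≤ S.quadCost v (S.opG *ᵥ delta x0 w) := by
      rw [quadCost, le_add_iff_nonneg_left]
      exact (posSemidef_calQ hQ).dotProduct_mulVec_nonneg _
    have h2 := (posSemidef_sub_sigmaMin (posDef_calR hR).posSemidef).dotProduct_mulVec_nonneg v
    simp only [star_trivial, Matrix.sub_mulVec, dotProduct_sub, Matrix.smul_mulVec,
        dotProduct_smul, Matrix.one_mulVec, smul_eq_mul, sub_nonneg, ← hr] at h2
    have h3 : μ * (delta x0 w ⬝ᵥ W *ᵥ delta x0 w) ≤ μ₁ * (delta x0 w ⬝ᵥ W *ᵥ delta x0 w) :=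
      mul_le_mul_of_nonneg_right hμ (hW.posSemidef.dotProduct_mulVec_nonneg _)
    have h4 : v i * v i ≤ v ⬝ᵥ v :=
      Finset.single_le_sum (f := fun i => v i * v i) (fun i _ => mul_self_nonneg _)
        (Finset.mem_univ i)
    refine Real.abs_le_sqrt ?_
    rw [le_div_iff₀ hr0, sq, mul_comm]
    have := mul_le_mul_of_nonneg_left h4 hr0.le
    linarith
  choose ε hε hεw using fun j : DistIdx T p => exists_pos_pointwiseBounded_smul hP.posSemidef
    (fun (k : Fin T) (a : Fin p) => if (a, k) = j then (1 : ℝ) else 0)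
  have h0 : PointwiseBounded P (0 : Fin T → Fin p → ℝ) := fun k => by simp
  refine ⟨Sum.elim (fun _ => b 0) fun j => (b (ε j • fun (k : Fin T) (a : Fin p) =>
    if (a, k) = j then (1 : ℝ) else 0) + b 0) / ε j, fun μ Ψ hμ h i j => ?_⟩
  have e0 : ∀ i, (Ψ *ᵥ aug 0) i = Ψ i (.inl ()) := fun i => by
    simp [Matrix.mulVec, dotProduct, aug]
  have hb0 := hbound 0 h0 μ Ψ hμ (h 0 h0) i
  rw [e0] at hb0
  rcases j with u | j
  · exact hb0
  · have hbj := hbound _ (hεw j) μ Ψ hμ (h _ (hεw j)) i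
    have ej : (Ψ *ᵥ aug (ε j • fun (k : Fin T) (a : Fin p) =>
        if (a, k) = j then (1 : ℝ) else 0)) i = Ψ i (.inl ()) + Ψ i (.inr j) * ε j := by
      simp [Matrix.mulVec, dotProduct, aug]
    rw [ej] at hbj
    rw [Sum.elim_inr, le_div_iff₀ (hε j)]
    calc |Ψ i (.inr j)| * ε j = |(Ψ i (.inl ()) + Ψ i (.inr j) * ε j) - Ψ i (.inl ())| := by
          rw [add_sub_cancel_left, abs_mul, abs_of_pos (hε j)]
      _ ≤ _ := (abs_sub _ _).trans (add_le_add hbj hb0)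

/-- The entry of the inequality at `(1, 0)` bounds the offset of the multiplier. -/
lemma multiplier_offset_le (hW : W.PosDef) {μ μ₁ s : ℝ} (hμ : μ ≤ μ₁)
    {Λ : Matrix (DistIdx T p) (DistIdx T p) ℝ} {Ψ : Matrix (InputIdx T m) (AugIdx T p) ℝ}
    (h : (S.slackMatrix W x0 μ Ψ
      + Matrix.fromBlocks (-(s • (1 : Matrix Unit Unit ℝ))) 0 0 Λ).PosSemidef) :
    s ≤ μ₁ * (delta x0 0 ⬝ᵥ W *ᵥ delta x0 0) := by
  have h1 := h.dotProduct_mulVec_nonneg (aug 0)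
  rw [star_trivial, Matrix.add_mulVec, dotProduct_add, aug_dotProduct_multiplier_mulVec_aug] at h1
  have h2 := slack_dotProduct_le hQ hR (W := W) (x0 := x0) μ Ψ (aug 0)
  rw [lift_mulVec_aug] at h2
  have h3 : μ * (delta x0 0 ⬝ᵥ W *ᵥ delta x0 0) ≤ μ₁ * (delta x0 0 ⬝ᵥ W *ᵥ delta x0 0) :=
    mul_le_mul_of_nonneg_right hμ
      (hW.posSemidef.dotProduct_mulVec_nonneg (delta x0 (0 : Fin T → Fin p → ℝ)))
  have h4 : (fun jk : DistIdx T p => (0 : Fin T → Fin p → ℝ) jk.2 jk.1) = 0 := rfl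
  rw [h4, zero_dotProduct] at h1
  linarith

lemma energySDP_nonempty [Nonempty (DeltaIdx T n p)] (hW : W.PosDef) (ω : ℝ) :
    (S.energySDP W ω x0).Nonempty := by
  have hWt : Wᵀ = W := hW.1
  obtain ⟨μ, hμ⟩ := exists_smul_sub_posSemidef hW (M := S.opGᵀ * S.calQ * S.opG - S.calO) (by
    rw [Matrix.IsHermitian, Matrix.conjTranspose_eq_transpose_of_trivial]
    simp only [Matrix.transpose_sub, Matrix.transpose_mul, Matrix.transpose_transpose,
      transpose_calQ hQ, transpose_calO hQ hR, Matrix.mul_assoc])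
  refine ⟨μ, (mem_energySDP_iff hQ hR hWt).2 ⟨0, le_rfl, 0, Submodule.zero_mem _, ?_⟩⟩
  have := hμ.conjTranspose_mul_mul_same (lift T p x0)
  have e : S.slackMatrix W x0 μ 0 + Matrix.fromBlocks (-((0 * ω) • (1 : Matrix Unit Unit ℝ))) 0 0
        ((0 : ℝ) • (1 : Matrix (DistIdx T p) (DistIdx T p) ℝ))
      = (lift T p x0)ᴴ * (μ • W - (S.opGᵀ * S.calQ * S.opG - S.calO)) * lift T p x0 := by
    rw [slackMatrix, regretMatrix, Matrix.conjTranspose_eq_transpose_of_trivial]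
    simp [Matrix.mul_sub, Matrix.sub_mul, Matrix.mul_assoc]
  rw [e]
  exact this

lemma energySDP_subset_pointwiseSDP [Nonempty (Fin p)] (hW : W.PosDef) (hP : P.PosDef) :
    S.energySDP W (T / sigmaMin P) x0 ⊆ S.pointwiseSDP W P x0 := by
  intro μ hμ
  obtain ⟨lam, hlam, Ψ, hΨ, h⟩ := (mem_energySDP_iff hQ hR hW.1).1 hμ
  exact (mem_pointwiseSDP_iff hQ hR hW.1).2 ⟨fun _ => lam / sigmaMin P,
    fun _ => div_nonneg hlam (sigmaMin_pos hP).le, Ψ, hΨ, pointwise_of_energy hP hlam h⟩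

lemma pointwiseSDP_subset_pwbLevels (hW : W.PosDef) :
    S.pointwiseSDP W P x0 ⊆ S.pwbLevels W P x0 := by
  intro μ hμ
  obtain ⟨lam, hlam, Ψ, hΨ, h⟩ := (mem_pointwiseSDP_iff hQ hR hW.1).1 hμ
  exact (mem_pwbLevels_iff hQ hR).2 ⟨Ψ, hΨ, fun w hw => slack_nonneg_of_multiplier hlam h hw⟩

theorem exists_isLeast_pwbLevels (hT : 0 < T) [Nonempty (Fin p)] (hW : W.PosDef) (hP : P.PosDef)
    (hne : (S.pwbLevels W P x0).Nonempty) : ∃ μ, IsLeast (S.pwbLevels W P x0) μ := by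
  refine exists_isLeast_of_isClosed (K := {q : ℝ × Matrix (InputIdx T m) (AugIdx T p) ℝ |
      q.2 ∈ responses T m p x0 ∧ ∀ w, PointwiseBounded P w →
        0 ≤ aug w ⬝ᵥ S.slackMatrix W x0 q.1 q.2 *ᵥ aug w}) ?_
    (fun μ => mem_pwbLevels_iff hQ hR) hne fun μ₁ => ?_
  · simp only [Set.ofPred_and, Set.ofPred_forall]
    refine ((isClosed_responses x0).preimage continuous_snd).inter
      (isClosed_iInter fun w => isClosed_iInter fun _ => isClosed_le continuous_const ?_)
    exact continuous_const.dotProduct ((continuous_slackMatrix W x0).matrix_mulVec continuous_const)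
  · obtain ⟨C, hC⟩ := exists_bound_response hQ hR (x0 := x0) hW hP μ₁
    exact ⟨_, isCompact_setOf_abs_le C, fun μ Ψ h hμ =>
      ⟨level_nonneg hQ hR hT hW hP h.2, hC μ Ψ hμ h.2⟩⟩

theorem exists_isLeast_pointwiseSDP (hT : 0 < T) [Nonempty (Fin p)] (hW : W.PosDef) (hP : P.PosDef)
    (hne : (S.pointwiseSDP W P x0).Nonempty) : ∃ μ, IsLeast (S.pointwiseSDP W P x0) μ := by
  refine exists_isLeast_of_isClosed
    (K := {q : ℝ × (Fin T → ℝ) × Matrix (InputIdx T m) (AugIdx T p) ℝ |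
      (∀ i, 0 ≤ q.2.1 i) ∧ q.2.2 ∈ responses T m p x0 ∧ (S.slackMatrix W x0 q.1 q.2.2
        + Matrix.fromBlocks (-((∑ i, q.2.1 i) • (1 : Matrix Unit Unit ℝ))) 0 0
        (∑ i, q.2.1 i • calP P i)).PosSemidef}) ?_ (fun μ => ?_) hne fun μ₁ => ?_
  · simp only [Set.ofPred_and, Set.ofPred_forall]
    refine (isClosed_iInter fun i => isClosed_le continuous_const (by fun_prop)).inter
      (((isClosed_responses x0).preimage (by fun_prop)).inter
        (isClosed_setOf_posSemidef.preimage (.add ?_ ?_)))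
    · exact (continuous_slackMatrix W x0).comp (continuous_fst.prodMk continuous_snd.snd)
    · refine Continuous.matrix_fromBlocks ?_ continuous_const continuous_const ?_ <;> fun_prop
  · rw [mem_pointwiseSDP_iff hQ hR (W := W) hW.1]
    exact ⟨fun ⟨l, hl, Ψ, hΨ, h⟩ => ⟨(l, Ψ), hl, hΨ, h⟩,
      fun ⟨⟨l, Ψ⟩, hl, hΨ, h⟩ => ⟨l, hl, Ψ, hΨ, h⟩⟩
  · obtain ⟨C, hC⟩ := exists_bound_response hQ hR (x0 := x0) hW hP μ₁
    refine ⟨Set.Icc 0 (fun _ => μ₁ * (delta x0 0 ⬝ᵥ W *ᵥ delta x0 0)) ×ˢ _,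
      isCompact_Icc.prod (isCompact_setOf_abs_le C), ?_⟩
    rintro μ ⟨l, Ψ⟩ ⟨hl, -, h⟩ hμ
    have h' := fun w (hw : PointwiseBounded P w) => slack_nonneg_of_multiplier hl h hw
    refine ⟨level_nonneg hQ hR hT hW hP h', ⟨hl, fun i => ?_⟩, hC μ Ψ hμ h'⟩
    exact (Finset.single_le_sum (fun i _ => hl i) (Finset.mem_univ i)).trans
      (multiplier_offset_le hQ hR hW hμ h)

theorem exists_isLeast_energySDP (hT : 0 < T) [Nonempty (Fin p)] (hW : W.PosDef) (hP : P.PosDef)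
    (hne : (S.energySDP W (T / sigmaMin P) x0).Nonempty) :
    ∃ μ, IsLeast (S.energySDP W (T / sigmaMin P) x0) μ := by
  have hω : 0 < T / sigmaMin P := div_pos (by exact_mod_cast hT) (sigmaMin_pos hP)
  refine exists_isLeast_of_isClosed
    (K := {q : ℝ × ℝ × Matrix (InputIdx T m) (AugIdx T p) ℝ |
      0 ≤ q.2.1 ∧ q.2.2 ∈ responses T m p x0 ∧ (S.slackMatrix W x0 q.1 q.2.2
        + Matrix.fromBlocks (-((q.2.1 * (T / sigmaMin P)) • (1 : Matrix Unit Unit ℝ))) 0 0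
        (q.2.1 • (1 : Matrix (DistIdx T p) (DistIdx T p) ℝ))).PosSemidef}) ?_ (fun μ => ?_) hne
    fun μ₁ => ?_
  · simp only [Set.ofPred_and]
    refine (isClosed_le continuous_const (by fun_prop)).inter
      (((isClosed_responses x0).preimage (by fun_prop)).inter
        (isClosed_setOf_posSemidef.preimage (.add ?_ ?_)))
    · exact (continuous_slackMatrix W x0).comp (continuous_fst.prodMk continuous_snd.snd)
    · refine Continuous.matrix_fromBlocks ?_ continuous_const continuous_const ?_ <;> fun_prop
  · rw [mem_energySDP_iff hQ hR (W := W) hW.1]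
    exact ⟨fun ⟨l, hl, Ψ, hΨ, h⟩ => ⟨(l, Ψ), hl, hΨ, h⟩,
      fun ⟨⟨l, Ψ⟩, hl, hΨ, h⟩ => ⟨l, hl, Ψ, hΨ, h⟩⟩
  · obtain ⟨C, hC⟩ := exists_bound_response hQ hR (x0 := x0) hW hP μ₁
    refine ⟨Set.Icc 0 (μ₁ * (delta x0 0 ⬝ᵥ W *ᵥ delta x0 0) / (T / sigmaMin P)) ×ˢ _,
      isCompact_Icc.prod (isCompact_setOf_abs_le C), ?_⟩
    rintro μ ⟨l, Ψ⟩ ⟨hl, -, h⟩ hμ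
    have h' := fun w (hw : PointwiseBounded P w) => slack_nonneg_of_multiplier
      (fun _ => div_nonneg hl (sigmaMin_pos hP).le) (pointwise_of_energy hP hl h) hw
    refine ⟨level_nonneg hQ hR hT hW hP h', ⟨hl, ?_⟩, hC μ Ψ hμ h'⟩
    rw [le_div_iff₀ hω]
    exact multiplier_offset_le hQ hR hW hμ h

end LQData

/-! ### The lower bound -/

/-- The change of coordinates that applies `U` to every block of `𝐰` and keeps `t`. -/
def augRotation (T : ℕ) (U : Matrix (Fin p) (Fin p) ℝ) : Matrix (AugIdx T p) (AugIdx T p) ℝ :=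
  Matrix.fromBlocks 1 0 0 (Matrix.blockDiagonal fun _ : Fin T => U)

lemma augRotation_mulVec (U : Matrix (Fin p) (Fin p) ℝ) (t : ℝ) (y : DistIdx T p → ℝ) :
    augRotation T U *ᵥ Sum.elim (fun _ => t) y
      = Sum.elim (fun _ => t) fun jk => (U *ᵥ fun a => y (a, jk.2)) jk.1 := by
  rw [augRotation, Matrix.fromBlocks_mulVec]
  simp only [Sum.elim_comp_inl, Sum.elim_comp_inr, Matrix.zero_mulVec, add_zero, zero_add,
    Matrix.one_mulVec]
  congr 1
  ext ⟨j, k⟩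
  exact blockDiagonal_mulVec_apply _ _ _ _

lemma dotProduct_diagonal_mulVec_sumElim (c : AugIdx T p → ℝ) (t : ℝ) (y : DistIdx T p → ℝ) :
    Sum.elim (fun _ => t) y ⬝ᵥ Matrix.diagonal c *ᵥ Sum.elim (fun _ => t) y
      = c (.inl ()) * t ^ 2 + ∑ j, c (.inr j) * y j ^ 2 := by
  simp only [dotProduct, Matrix.mulVec_diagonal, Fintype.sum_sum_type, Sum.elim_inl, Sum.elim_inr,
    Finset.univ_unique, Finset.sum_singleton]
  congr 1
  · change t * (c (.inl ()) * t) = _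
    ring
  · exact Finset.sum_congr rfl fun j _ => by ring

lemma sum_ite_snd_mul (d : Fin p → ℝ) (i : Fin T) (y : DistIdx T p → ℝ) :
    ∑ j : DistIdx T p, (if j.2 = i then d j.1 else 0) * y j ^ 2 = ∑ a, d a * y (a, i) ^ 2 := by
  simp [Fintype.sum_prod_type]

lemma dotProduct_sum_smul_blockConstraint_mulVec (d : Fin p → ℝ) (lam : Fin T → ℝ) (t : ℝ)
    (y : DistIdx T p → ℝ) :
    Sum.elim (fun _ => t) y ⬝ᵥ (∑ i, lam i • blockConstraint (fun j : DistIdx T p => j.2)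
        (fun j => d j.1) i) *ᵥ Sum.elim (fun _ => t) y
      = ∑ i, lam i * (∑ a, d a * y (a, i) ^ 2 - t ^ 2) := by
  rw [Matrix.sum_mulVec, dotProduct_sum]
  refine Finset.sum_congr rfl fun i _ => ?_
  rw [Matrix.smul_mulVec, dotProduct_smul, smul_eq_mul, blockConstraint,
    dotProduct_diagonal_mulVec_sumElim,
    ← sum_ite_snd_mul]
  simp only [Sum.elim_inl, Sum.elim_inr]
  ring

lemma dotProduct_lift_mulVec_self (x0 : Fin n → ℝ) (t : ℝ) (y : DistIdx T p → ℝ) :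
    (lift T p x0 *ᵥ Sum.elim (fun _ => t) y) ⬝ᵥ (lift T p x0 *ᵥ Sum.elim (fun _ => t) y)
      = x0 ⬝ᵥ x0 * t ^ 2 + ∑ j, y j ^ 2 := by
  rw [lift_mulVec_sumElim, sumElim_dotProduct_sumElim, smul_dotProduct, dotProduct_smul]
  simp only [smul_eq_mul, dotProduct, ← sq]
  ring

namespace LQData

variable {S : LQData T n m p} {W : Matrix (DeltaIdx T n p) (DeltaIdx T n p) ℝ}
  {P : Matrix (Fin p) (Fin p) ℝ} {x0 : Fin n → ℝ}
  (hQ : ∀ k, (S.Q k).PosSemidef) (hR : ∀ k, (S.R k).PosDef)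
include hQ hR

lemma isHermitian_slackMatrix (hW : W.IsHermitian) (μ : ℝ)
    (Ψ : Matrix (InputIdx T m) (AugIdx T p) ℝ) : (S.slackMatrix W x0 μ Ψ).IsHermitian := by
  refine Matrix.IsHermitian.sub (Matrix.IsHermitian.smul ?_ (IsSelfAdjoint.all _))
    (posSemidef_regretMatrix hQ hR x0 Ψ).1
  exact Matrix.isHermitian_conjTranspose_mul_mul (lift T p x0) hW

omit hQ hR in
lemma isHermitian_multiplier {Λ : Matrix (DistIdx T p) (DistIdx T p) ℝ} (hΛ : Λ.IsHermitian)
    (s : ℝ) : (Matrix.fromBlocks (-(s • (1 : Matrix Unit Unit ℝ))) 0 0 Λ).IsHermitian :=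
  Matrix.IsHermitian.fromBlocks (by simp [Matrix.IsHermitian]) (by simp) hΛ

/-- A guaranteed level is feasible for the pointwise program after multiplication by
`π / 2 * κ(W)`, up to an arbitrarily small loss. -/
theorem mem_pointwiseSDP_of_mem_pwbLevels (hT : 0 < T) [Nonempty (Fin p)] (hW : W.PosDef)
    (hP : P.PosDef) (hx0 : x0 ≠ 0) {μ ε : ℝ} (hμ : μ ∈ S.pwbLevels W P x0) (hε : 0 < ε) :
    Real.pi / 2 * condNumber W * μ + ε ∈ S.pointwiseSDP W P x0 := by
  have : Nonempty (DeltaIdx T n p) := ⟨.inr (Classical.arbitrary _, ⟨0, hT⟩)⟩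
  obtain ⟨Ψ, hΨ, h⟩ := (mem_pwbLevels_iff hQ hR).1 hμ
  have hμ0 : 0 ≤ μ := level_nonneg hQ hR hT hW hP h
  have hσ : 0 < sigmaMin W := sigmaMin_pos hW
  have hx : 0 < x0 ⬝ᵥ x0 := 
    lt_of_le_of_ne (by simpa using dotProduct_star_self_nonneg x0)
      fun h0 => hx0 (dotProduct_self_eq_zero.1 h0.symm)
  obtain ⟨U, hU1, hU2, hPU⟩ := exists_orthogonal_diagonalization hP.1
  set d := hP.1.eigenvalues with hd
  have hd0 : ∀ a, 0 < d a := hP.eigenvalues_pos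
  have hrotP : ∀ v, (U *ᵥ v) ⬝ᵥ P *ᵥ (U *ᵥ v) = ∑ a, d a * v a ^ 2 := fun v => by
    rw [← dotProduct_conj_mulVec, hPU]
    have : Uᵀ * (U * Matrix.diagonal d * Uᵀ) * U = Matrix.diagonal d := by
      calc Uᵀ * (U * Matrix.diagonal d * Uᵀ) * U
          = (Uᵀ * U) * Matrix.diagonal d * (Uᵀ * U) := by simp only [Matrix.mul_assoc]
        _ = Matrix.diagonal d := by rw [hU1, Matrix.one_mul, Matrix.mul_one]
    rw [this]
    simp only [dotProduct, Matrix.mulVec_diagonal]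
    exact Finset.sum_congr rfl fun a _ => by ring
  have hrot : ∀ y : DistIdx T p → ℝ,
      ∑ j : DistIdx T p, (U *ᵥ fun a => y (a, j.2)) j.1 ^ 2 = ∑ j, y j ^ 2 := fun y => by
    rw [Fintype.sum_prod_type_right, Fintype.sum_prod_type_right]
    refine Finset.sum_congr rfl fun k _ => ?_
    have := dotProduct_conj_mulVec 1 U fun a => y (a, k)
    rw [Matrix.mul_one, hU1, Matrix.one_mulVec, Matrix.one_mulVec] at this
    simpa only [dotProduct, ← sq] using this.symm
  have hN := posSemidef_regretMatrix hQ hR x0 Ψ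
  have hquad : ∀ (ν : ℝ) z, z ⬝ᵥ S.slackMatrix W x0 ν Ψ *ᵥ z
      = ν * ((lift T p x0 *ᵥ z) ⬝ᵥ W *ᵥ (lift T p x0 *ᵥ z)) - z ⬝ᵥ S.regretMatrix x0 Ψ *ᵥ z :=
    fun ν z => by
      rw [slackMatrix, Matrix.sub_mulVec, dotProduct_sub, Matrix.smul_mulVec, dotProduct_smul,
        dotProduct_conj_mulVec, smul_eq_mul]
  set V := augRotation T U with hV
  set q : AugIdx T p → ℝ := Sum.elim (fun _ => μ * sigmaMax W * (x0 ⬝ᵥ x0))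
    fun _ => μ * sigmaMax W with hq
  set e : AugIdx T p → ℝ := Sum.elim (fun _ => ε * sigmaMin W * (x0 ⬝ᵥ x0))
    fun _ => ε * sigmaMin W with he
  -- `q` is the form `μ σ_max(W) |L z|²` and `e` the form `ε σ_min(W) |L z|²`; both are invariant
  -- under the rotation `V` that diagonalises `P`
  obtain ⟨lam, hlam, hpsd⟩ := exists_multiplier_of_le_diagonal (q := q) (e := e)
    (hN.conjTranspose_mul_mul_same V) (fun j : DistIdx T p => j.2) (d := fun j => d j.1)
    (fun j => hd0 _) (by rintro (u | j) <;> simp only [he, Sum.elim_inl, Sum.elim_inr] <;> positivity)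
    fun y hy => by
      set w : Fin T → Fin p → ℝ := fun k => U *ᵥ fun a => y (a, k) with hw
      have hVw : V *ᵥ Sum.elim (fun _ => 1) y = aug w := augRotation_mulVec U 1 y
      have hwP : PointwiseBounded P w := fun k => by
        rw [hw]; simp only
        rw [hrotP, ← sum_ite_snd_mul]
        exact hy k
      have h1 := h w hwP
      rw [hquad] at h1
      have h2 := (posSemidef_sigmaMax_sub hW.posSemidef).dotProduct_mulVec_nonneg
        (lift T p x0 *ᵥ aug w)
      simp only [star_trivial, Matrix.sub_mulVec, dotProduct_sub, Matrix.smul_mulVec,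
        dotProduct_smul, Matrix.one_mulVec, smul_eq_mul, sub_nonneg] at h2
      have h3 : (lift T p x0 *ᵥ aug w) ⬝ᵥ (lift T p x0 *ᵥ aug w)
          = x0 ⬝ᵥ x0 + ∑ j, y j ^ 2 := by
        rw [aug, dotProduct_lift_mulVec_self, one_pow, mul_one]
        exact congrArg _ (hrot y)
      rw [h3] at h2
      rw [Matrix.conjTranspose_eq_transpose_of_trivial, dotProduct_conj_mulVec, hVw,
        Fintype.sum_sum_type]
      simp only [hq, Sum.elim_inl, Sum.elim_inr, Finset.univ_unique, Finset.sum_singleton,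
        ← Finset.mul_sum, one_pow, mul_one]
      have h4 := mul_le_mul_of_nonneg_left h2 hμ0
      linarith
  refine (mem_pointwiseSDP_iff hQ hR (W := W) hW.1).2 ⟨lam, hlam, Ψ, hΨ, .of_dotProduct_mulVec_nonneg
    ((isHermitian_slackMatrix hQ hR hW.1 _ _).add
      (isHermitian_multiplier (isHermitian_sum_smul_calP hP.1 _) _)) fun z => ?_⟩
  obtain ⟨t, y, rfl⟩ : ∃ (t : ℝ) (y : DistIdx T p → ℝ), z = V *ᵥ Sum.elim (fun _ => t) y := by
    refine ⟨z (.inl ()), fun jk => (Uᵀ *ᵥ fun a => z (.inr (a, jk.2))) jk.1, ?_⟩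
    rw [hV, augRotation_mulVec]
    ext (u | ⟨j, k⟩)
    · rfl
    · simp only [Sum.elim_inr]
      have : (fun a => (Uᵀ *ᵥ fun a => z (.inr (a, k))) a) = Uᵀ *ᵥ fun a => z (.inr (a, k)) := rfl
      rw [this, Matrix.mulVec_mulVec, hU2, Matrix.one_mulVec]
  have h1 := hpsd.dotProduct_mulVec_nonneg (Sum.elim (fun _ => t) y)
  rw [star_trivial, Matrix.add_mulVec, Matrix.sub_mulVec, dotProduct_add, dotProduct_sub,
    dotProduct_diagonal_mulVec_sumElim, dotProduct_sum_smul_blockConstraint_mulVec,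
    Matrix.conjTranspose_eq_transpose_of_trivial, dotProduct_conj_mulVec] at h1
  rw [star_trivial, Matrix.add_mulVec, dotProduct_add, hquad]
  have h2 := (posSemidef_sub_sigmaMin hW.posSemidef).dotProduct_mulVec_nonneg
    (lift T p x0 *ᵥ (V *ᵥ Sum.elim (fun _ => t) y))
  simp only [star_trivial, Matrix.sub_mulVec, dotProduct_sub, Matrix.smul_mulVec,
    dotProduct_smul, Matrix.one_mulVec, smul_eq_mul, sub_nonneg] at h2
  set ν := Real.pi / 2 * condNumber W * μ + ε with hν
  have hκ : condNumber W * sigmaMin W = sigmaMax W := div_mul_cancel₀ _ hσ.ne'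
  have hκ0 : 0 ≤ condNumber W := div_nonneg (hσ.le.trans (sigmaMin_le_sigmaMax W)) hσ.le
  have hν0 : 0 ≤ ν := by positivity
  have hνσ : ν * sigmaMin W = Real.pi / 2 * (μ * sigmaMax W) + ε * sigmaMin W := by
    rw [hν, ← hκ]; ring
  have h3 := mul_le_mul_of_nonneg_left h2 hν0
  have h5 : (lift T p x0 *ᵥ (V *ᵥ Sum.elim (fun _ => t) y)) ⬝ᵥ
      (lift T p x0 *ᵥ (V *ᵥ Sum.elim (fun _ => t) y)) = x0 ⬝ᵥ x0 * t ^ 2 + ∑ j, y j ^ 2 := by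
    rw [hV, augRotation_mulVec, dotProduct_lift_mulVec_self, hrot]
  have h6 : (V *ᵥ Sum.elim (fun _ => t) y) ⬝ᵥ Matrix.fromBlocks
      (-((∑ i, lam i) • (1 : Matrix Unit Unit ℝ))) 0 0 (∑ i, lam i • calP P i)
        *ᵥ (V *ᵥ Sum.elim (fun _ => t) y)
      = ∑ i, lam i * (∑ a, d a * y (a, i) ^ 2 - t ^ 2) := by
    rw [hV, augRotation_mulVec, dotProduct_multiplier_mulVec, dotProduct_sum_smul_calP_mulVec]
    have : ∀ i, ((fun j => (U *ᵥ fun a => y (a, i)) j) ⬝ᵥ P *ᵥ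
        fun j => (U *ᵥ fun a => y (a, i)) j) = ∑ a, d a * y (a, i) ^ 2 := fun i => hrotP _
    simp only [this, mul_sub, Finset.sum_sub_distrib, ← Finset.sum_mul]
    ring
  rw [h6]
  rw [h5, ← mul_assoc, hνσ] at h3
  simp only [hq, he, Sum.elim_inl, Sum.elim_inr, ← Finset.mul_sum] at h1
  nlinarith

/-- For `x_0 = 0` the regret is homogeneous in `𝐰`, so a bound for small disturbances is a bound for
all of them, and no multiplier is needed. -/
theorem pwbLevels_subset_pointwiseSDP_of_zero (hW : W.PosDef) (hP : P.PosDef) :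
    S.pwbLevels W P 0 ⊆ S.pointwiseSDP W P 0 := by
  intro μ hμ
  obtain ⟨Ψ, ⟨Φu, hΦ, rfl⟩, h⟩ := (mem_pwbLevels_iff hQ hR).1 hμ
  refine (mem_pointwiseSDP_iff hQ hR (W := W) hW.1).2 ⟨0, fun i => le_rfl, _, ⟨Φu, hΦ, rfl⟩, ?_⟩
  have e : Matrix.fromBlocks (-((∑ i, (0 : Fin T → ℝ) i) • (1 : Matrix Unit Unit ℝ))) 0 0
      (∑ i, (0 : Fin T → ℝ) i • calP P i) = 0 := by simp
  rw [e, add_zero]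
  refine .of_dotProduct_mulVec_nonneg (isHermitian_slackMatrix hQ hR hW.1 _ _) fun z => ?_
  rw [star_trivial]
  obtain ⟨ε, hε, hw⟩ := exists_pos_pointwiseBounded_smul hP.posSemidef
    fun (k : Fin T) (a : Fin p) => z (.inr (a, k))
  have h1 := h _ hw
  have hL : lift T p (0 : Fin n → ℝ) *ᵥ aug (ε • fun (k : Fin T) (a : Fin p) => z (.inr (a, k)))
      = lift T p (0 : Fin n → ℝ) *ᵥ (ε • z) := by
    rw [lift_mulVec_aug]
    have : ε • z = Sum.elim (fun _ => ε * z (.inl ())) fun j => ε * z (.inr j) := by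
      ext (u | j) <;> rfl
    rw [this, lift_mulVec_sumElim, smul_zero]
    rfl
  have hquad : ∀ z₁ z₂, lift T p (0 : Fin n → ℝ) *ᵥ z₁ = lift T p (0 : Fin n → ℝ) *ᵥ z₂ →
      z₁ ⬝ᵥ S.slackMatrix W 0 μ (Φu * lift T p (0 : Fin n → ℝ)) *ᵥ z₁
        = z₂ ⬝ᵥ S.slackMatrix W 0 μ (Φu * lift T p (0 : Fin n → ℝ)) *ᵥ z₂ := fun z₁ z₂ hz => by
    simp only [slackMatrix, Matrix.sub_mulVec, dotProduct_sub, Matrix.smul_mulVec, dotProduct_smul,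
      dotProduct_conj_mulVec, dotProduct_regretMatrix_mulVec]
    simp only [← Matrix.mulVec_mulVec, hz]
  rw [hquad _ _ hL, Matrix.mulVec_smul, smul_dotProduct, dotProduct_smul, smul_eq_mul, smul_eq_mul,
    ← mul_assoc] at h1
  exact nonneg_of_mul_nonneg_right h1 (mul_pos hε hε)

end LQData

end GenRegret

end

theorem theorem2 {T n m p : ℕ} (hT : 0 < T) (hn : 0 < n)
    (S : GenRegret.LQData T n m p)
    (hE : ∀ k, (S.E k).rank = n)
    (hQ : ∀ k, (S.Q k).PosSemidef) (hR : ∀ k, (S.R k).PosDef)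
    (W : Matrix (GenRegret.DeltaIdx T n p) (GenRegret.DeltaIdx T n p) ℝ) (hW : W.PosDef)
    (P : Matrix (Fin p) (Fin p) ℝ) (hP : P.PosDef)
    (x0 : Fin n → ℝ) :
    ∃ μPWB μbar μstar : ℝ,
      IsLeast (S.pwbLevels W P x0) μPWB ∧
      (p = n → IsLeast (S.pwbFeedbackLevels W P x0) μPWB) ∧
      IsLeast (S.pointwiseSDP W P x0) μbar ∧
      IsLeast (S.energySDP W ((T : ℝ) / GenRegret.sigmaMin P) x0) μstar ∧
      2 / (Real.pi * GenRegret.condNumber W) * μbar ≤ μPWB ∧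
      μPWB ≤ μbar ∧ μbar ≤ μstar := by
  open GenRegret GenRegret.LQData in
  have hp : 0 < p := by
    have h1 := (S.E ⟨0, hT⟩).rank_le_width
    rw [hE] at h1
    omega
  have : Nonempty (Fin p) := ⟨⟨0, hp⟩⟩
  have : Nonempty (DeltaIdx T n p) := ⟨.inl ⟨0, hn⟩⟩
  have hsub₁ : S.energySDP W (T / sigmaMin P) x0 ⊆ S.pointwiseSDP W P x0 :=
    energySDP_subset_pointwiseSDP hQ hR hW hP
  have hsub₂ : S.pointwiseSDP W P x0 ⊆ S.pwbLevels W P x0 :=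
    pointwiseSDP_subset_pwbLevels hQ hR hW
  have hne := energySDP_nonempty hQ hR (x0 := x0) hW (T / sigmaMin P)
  obtain ⟨μstar, hstar⟩ := exists_isLeast_energySDP hQ hR hT hW hP hne
  obtain ⟨μbar, hbar⟩ := exists_isLeast_pointwiseSDP hQ hR hT hW hP (hne.mono hsub₁)
  obtain ⟨μPWB, hPWB⟩ := exists_isLeast_pwbLevels hQ hR hT hW hP (hne.mono (hsub₁.trans hsub₂))
  refine ⟨μPWB, μbar, μstar, hPWB, ?_, hbar, hstar, ?_, hPWB.2 (hsub₂ hbar.1),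
    hbar.2 (hsub₁ hstar.1)⟩
  · rintro rfl
    rw [S.pwbFeedbackLevels_eq fun k => isUnit_of_rank_eq (hE k)]
    exact hPWB
  · have hσ : 0 < sigmaMin W := sigmaMin_pos hW
    have hκ : 1 ≤ condNumber W := (one_le_div hσ).2 (sigmaMin_le_sigmaMax W)
    have hle : μbar ≤ Real.pi / 2 * condNumber W * μPWB := by
      rcases eq_or_ne x0 0 with rfl | hx0
      · have h1 := hbar.2 (pwbLevels_subset_pointwiseSDP_of_zero hQ hR hW hP hPWB.1)
        obtain ⟨Ψ, -, h⟩ := (mem_pwbLevels_iff hQ hR).1 hPWB.1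
        have h2 : 0 ≤ μPWB := level_nonneg hQ hR hT hW hP h
        refine h1.trans (le_mul_of_one_le_left h2 ?_)
        nlinarith [Real.pi_gt_three]
      · exact le_of_forall_pos_le_add fun ε hε =>
          hbar.2 (mem_pointwiseSDP_of_mem_pwbLevels hQ hR hT hW hP hx0 hPWB.1 hε)
    have hπκ : 0 < Real.pi * condNumber W := mul_pos Real.pi_pos (by linarith)
    rw [div_mul_eq_mul_div, div_le_iff₀ hπκ]
    linarith
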